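/- Consider the discrete-time system $x_{t+1}=Ax_t+Bu_t+B_ww_t$ with $A\in\mathbb{R}^{n_x\times n_x}$, $B\in\mathbb{R}^{n_x\times n_u}$, $B_w\in\mathbb{R}^{n_x\times n_w}$, full state measurement $y_t=x_t$ (that is, $C=I_{n_x}$) and static state feedback $u_t=Kx_t$, $K\in\mathbb{R}^{n_u\times n_x}$. Let $Q\in\mathbb{R}^{n_x\times n_x}$ and $R\in\mathbb{R}^{n_u\times n_u}$ be symmetric positive definite, let $(A,B)$ be stabilizable, and let $B_w$ have full row rank. Let $$\mathcal{K}=\{K\in\mathbb{R}^{n_u\times n_x}\mid \rho(A+BK)<1\},$$ where $\rho$ is the spectral radius, be nonempty, and for $K\in\mathcal{K}$ define the $\mathcal{H}_\infty$ cost $$J(K)=\max_{\omega\in[0,2\pi]}\sigma_{\max}\!\left(\begin{bmatrix}Q^{1/2}\\ R^{1/2}K\end{bmatrix}\left(e^{j\omega}I-(A+BK)\right)^{-1}B_w\right),$$ where $\sigma_{\max}$ is the maximum singular value. Let $\partial J(K)$ be the Clarke subdifferential of $J$ at $K$ with respect to the Frobenius inner product: $$\partial J(K)=\Big\{G\in\mathbb{R}^{n_u\times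 n_x}\;\Big|\;\operatorname{Tr}(G^{\mathsf T}V)\le\limsup_{K'\to K,\;t\downarrow 0}\frac{J(K'+tV)-J(K')}{t}\ \text{ for all }V\in\mathbb{R}^{n_u\times n_x}\Big\}.$$ Then, for every $K\in\mathcal{K}$, $$0\in\partial J(K)\iff K\in\operatorname*{arg\,min}_{K'\in\mathcal{K}}J(K').$$ -/

import Mathlib

open scoped Matrix MatrixOrder Topology

noncomputable section

/-- The spectral radius of a real square matrix, i.e. the largest modulus of its complex
eigenvalues, is less than one. -/
def IsSchurStable {n : ℕ} (M : Matrix (Fin n) (Fin n) ℝ) : Prop :=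
  spectralRadius ℂ (M.map Complex.ofReal) < 1

/-- The pair `(A, B)` is stabilizable: some state feedback `F` makes `A + B F` stable. -/
def IsStabilizable {nx nu : ℕ} (A : Matrix (Fin nx) (Fin nx) ℝ)
    (B : Matrix (Fin nx) (Fin nu) ℝ) : Prop :=
  ∃ F : Matrix (Fin nu) (Fin nx) ℝ, IsSchurStable (A + B * F)

/-- The set of stabilizing static output-feedback gains. -/
def stabilizingSet {nx nu ny : ℕ} (A : Matrix (Fin nx) (Fin nx) ℝ)
    (B : Matrix (Fin nx) (Fin nu) ℝ) (C : Matrix (Fin ny) (Fin nx) ℝ) :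
    Set (Matrix (Fin nu) (Fin ny) ℝ) :=
  {K | IsSchurStable (A + B * K * C)}

/-- The maximum singular value of a complex matrix
(singular values are listed in decreasing order, starting from index `0`). -/
def sigmaMax {m n : Type*} [Fintype m] [Fintype n] [DecidableEq m] [DecidableEq n]
    (M : Matrix m n ℂ) : ℝ :=
  (Matrix.toEuclideanLin M).singularValues 0

/-- The closed-loop transfer matrix
`[Q^{1/2}; R^{1/2} K C] (e^{jω} I - (A + B K C))⁻¹ B_w`. -/
def closedLoopTransfer {nx nu nw ny : ℕ} (A : Matrix (Fin nx) (Fin nx) ℝ)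
    (B : Matrix (Fin nx) (Fin nu) ℝ) (Bw : Matrix (Fin nx) (Fin nw) ℝ)
    (C : Matrix (Fin ny) (Fin nx) ℝ) (Q : Matrix (Fin nx) (Fin nx) ℝ)
    (R : Matrix (Fin nu) (Fin nu) ℝ) (K : Matrix (Fin nu) (Fin ny) ℝ) (ω : ℝ) :
    Matrix (Fin nx ⊕ Fin nu) (Fin nw) ℂ :=
  (Matrix.fromRows (CFC.sqrt Q) (CFC.sqrt R * K * C)).map Complex.ofReal *
    (Complex.exp (Complex.I * ω) • (1 : Matrix (Fin nx) (Fin nx) ℂ) -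
      (A + B * K * C).map Complex.ofReal)⁻¹ *
    Bw.map Complex.ofReal

/-- The `H∞` cost of a gain `K`. It is meaningful on the stabilizing set, where the supremum
is a maximum (`exists_hInfCost_eq`). -/
def hInfCost {nx nu nw ny : ℕ} (A : Matrix (Fin nx) (Fin nx) ℝ)
    (B : Matrix (Fin nx) (Fin nu) ℝ) (Bw : Matrix (Fin nx) (Fin nw) ℝ)
    (C : Matrix (Fin ny) (Fin nx) ℝ) (Q : Matrix (Fin nx) (Fin nx) ℝ)
    (R : Matrix (Fin nu) (Fin nu) ℝ) (K : Matrix (Fin nu) (Fin ny) ℝ) : ℝ :=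
  ⨆ ω : Set.Icc (0 : ℝ) (2 * Real.pi), sigmaMax (closedLoopTransfer A B Bw C Q R K ω)

/-- The Clarke directional derivative
`f°(x; v) = limsup_{y → x, t ↓ 0} (f (y + t v) - f y) / t`, as an extended real number.
It depends only on `f` near `x`. -/
def clarkeDirDeriv {E : Type*} [AddCommGroup E] [Module ℝ E] [TopologicalSpace E]
    (f : E → ℝ) (x v : E) : EReal :=
  Filter.limsup (fun p : E × ℝ => (((f (p.1 + p.2 • v) - f p.1) / p.2 : ℝ) : EReal))
    (𝓝 x ×ˢ 𝓝[>] (0 : ℝ))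

/-- The Clarke subdifferential of a function of a real matrix, with respect to the
Frobenius inner product `⟨G, V⟩ = Tr (Gᵀ V)`. -/
def clarkeSubdifferential {m n : ℕ} (f : Matrix (Fin m) (Fin n) ℝ → ℝ)
    (K : Matrix (Fin m) (Fin n) ℝ) : Set (Matrix (Fin m) (Fin n) ℝ) :=
  {G | ∀ V : Matrix (Fin m) (Fin n) ℝ,
    (((Gᵀ * V).trace : ℝ) : EReal) ≤ clarkeDirDeriv f K V}

/-- The set of global minimizers of `f` over `S`. -/
def argMinOn {E : Type*} (f : E → ℝ) (S : Set E) : Set E :=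
  {x | x ∈ S ∧ IsMinOn f S x}

end

/-- The maximum singular value is the operator norm for the Euclidean norms. -/
theorem sigmaMax_eq_norm {m n : Type*} [Fintype m] [Fintype n] [DecidableEq m] [DecidableEq n]
    (M : Matrix m n ℂ) :
    sigmaMax M = ‖LinearMap.toContinuousLinearMap (Matrix.toEuclideanLin M)‖ := by
  unfold sigmaMax
  set T := Matrix.toEuclideanLin M with hT
  have hsym := T.isSymmetric_adjoint_comp_self
  have hfin : Module.finrank ℂ (EuclideanSpace ℂ n) = Module.finrank ℂ (EuclideanSpace ℂ n) := rfl
  set d := Module.finrank ℂ (EuclideanSpace ℂ n) with hd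
  have key : ∀ x, ‖T x‖ ^ 2 = RCLike.re (inner ℂ ((LinearMap.adjoint T ∘ₗ T) x) x) := by
    intro x
    rw [LinearMap.comp_apply, LinearMap.adjoint_inner_left, inner_self_eq_norm_sq]
  apply le_antisymm
  · rcases Nat.eq_zero_or_pos d with h0 | hpos
    · rw [T.singularValues_of_finrank_le (by omega)]
      positivity
    · let b := hsym.eigenvectorBasis hfin
      let i : Fin d := ⟨0, hpos⟩
      have hb : ‖b i‖ = 1 := b.orthonormal.1 i
      have h1 : ‖T (b i)‖ ^ 2 = T.singularValues 0 ^ 2 := by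
        rw [key, T.sq_singularValues_of_lt hfin hpos, hsym.apply_eigenvectorBasis hfin i,
          inner_smul_left, inner_self_eq_norm_sq_to_K, hb]
        simp [i]
      have h2 : ‖T (b i)‖ = T.singularValues 0 :=
        (sq_eq_sq₀ (norm_nonneg _) (T.singularValues_nonneg 0)).1 h1
      have h3 := (LinearMap.toContinuousLinearMap T).le_opNorm (b i)
      rw [hb, mul_one] at h3
      rw [← h2]
      exact h3
  · refine ContinuousLinearMap.opNorm_le_bound _ (T.singularValues_nonneg 0) fun x => ?_
    rw [LinearMap.coe_toContinuousLinearMap']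
    refine (sq_le_sq₀ (norm_nonneg _)
      (mul_nonneg (T.singularValues_nonneg 0) (norm_nonneg _))).1 ?_
    let b := hsym.eigenvectorBasis hfin
    rw [key, mul_pow, ← b.sum_inner_mul_inner, map_sum, ← b.sum_sq_norm_inner_right x,
      Finset.mul_sum]
    refine Finset.sum_le_sum fun i _ => ?_
    have h1 : inner ℂ ((LinearMap.adjoint T ∘ₗ T) x) (b i)
        = ((T.singularValues i ^ 2 : ℝ) : ℂ) * inner ℂ x (b i) := by
      rw [hsym x (b i), hsym.apply_eigenvectorBasis hfin i, inner_smul_right,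
        T.sq_singularValues_fin hfin i]
      rfl
    have h2 : inner ℂ x (b i) * inner ℂ (b i) x = ((‖inner ℂ (b i) x‖ ^ 2 : ℝ) : ℂ) := by
      rw [← inner_conj_symm x (b i), Complex.conj_mul']
      norm_cast
    rw [h1, mul_assoc, h2, ← Complex.ofReal_mul]
    have h3 : T.singularValues i ≤ T.singularValues 0 :=
      T.singularValues_antitone (Nat.zero_le _)
    have h4 := T.singularValues_nonneg i
    change T.singularValues i ^ 2 * ‖inner ℂ (b i) x‖ ^ 2 ≤ _
    gcongr

theorem continuous_sigmaMax {m n : Type*} [Fintype m] [Fintype n] [DecidableEq m]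
    [DecidableEq n] : Continuous (sigmaMax : Matrix m n ℂ → ℝ) := by
  have hl : Continuous ((Matrix.toEuclideanLin (𝕜 := ℂ) (m := m) (n := n)).trans
      LinearMap.toContinuousLinearMap).toLinearMap :=
    LinearMap.continuous_of_finiteDimensional _
  have h : (sigmaMax : Matrix m n ℂ → ℝ) = fun M =>
      ‖((Matrix.toEuclideanLin (𝕜 := ℂ) (m := m) (n := n)).trans
        LinearMap.toContinuousLinearMap).toLinearMap M‖ := by
    funext M
    exact sigmaMax_eq_norm M
  rw [h]
  exact hl.norm

theorem continuous_sigmaMax_closedLoopTransfer {nx nu nw ny : ℕ} (A : Matrix (Fin nx) (Fin nx) ℝ)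
    (B : Matrix (Fin nx) (Fin nu) ℝ) (Bw : Matrix (Fin nx) (Fin nw) ℝ)
    (C : Matrix (Fin ny) (Fin nx) ℝ) (Q : Matrix (Fin nx) (Fin nx) ℝ)
    (R : Matrix (Fin nu) (Fin nu) ℝ) (K : Matrix (Fin nu) (Fin ny) ℝ)
    (hK : K ∈ stabilizingSet A B C) :
    Continuous fun ω : ℝ => sigmaMax (closedLoopTransfer A B Bw C Q R K ω) := by
  refine continuous_sigmaMax.comp ?_
  unfold closedLoopTransfer
  refine (continuous_const.matrix_mul ?_).matrix_mul continuous_const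
  set N := (A + B * K * C).map Complex.ofReal with hN
  have hc : Continuous fun ω : ℝ =>
      Complex.exp (Complex.I * ω) • (1 : Matrix (Fin nx) (Fin nx) ℂ) - N := by fun_prop
  have hdet : ∀ ω : ℝ,
      (Complex.exp (Complex.I * ω) • (1 : Matrix (Fin nx) (Fin nx) ℂ) - N).det ≠ 0 := by
    intro ω h0
    have hmem : Complex.exp (Complex.I * ω) ∈ spectrum ℂ N := by
      rw [spectrum.mem_iff, Algebra.algebraMap_eq_smul_one, Matrix.isUnit_iff_isUnit_det, h0]
      simp
    have hle : (‖Complex.exp (Complex.I * ω)‖₊ : ENNReal) ≤ spectralRadius ℂ N :=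
      le_iSup₂ (f := fun k (_ : k ∈ spectrum ℂ N) => (‖k‖₊ : ENNReal)) _ hmem
    have hone : ‖Complex.exp (Complex.I * ω)‖₊ = 1 := by
      ext
      rw [coe_nnnorm, mul_comm, Complex.norm_exp_ofReal_mul_I]
      rfl
    rw [hone] at hle
    exact absurd (lt_of_le_of_lt hle hK) (by simp)
  simp only [Matrix.inv_def, Ring.inverse_eq_inv']
  exact (hc.matrix_det.inv₀ hdet).smul hc.matrix_adjugate

theorem exists_iSup_Icc_eq {a b : ℝ} (hab : a ≤ b) {g : ℝ → ℝ} (hg : Continuous g) :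
    ∃ ω ∈ Set.Icc a b, (⨆ x : Set.Icc a b, g x) = g ω ∧
      ∀ ω' ∈ Set.Icc a b, g ω' ≤ ⨆ x : Set.Icc a b, g x := by
  have hne : (Set.Icc a b).Nonempty := Set.nonempty_Icc.2 hab
  obtain ⟨ω, hω, hmax⟩ := isCompact_Icc.exists_isMaxOn hne hg.continuousOn
  have hm : ∀ ω' ∈ Set.Icc a b, g ω' ≤ g ω := fun ω' hω' => hmax hω'
  have : Nonempty (Set.Icc a b) := hne.to_subtype
  have hbdd : BddAbove (Set.range fun x : Set.Icc a b => g x) :=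
    ⟨g ω, by rintro _ ⟨x, rfl⟩; exact hm x x.2⟩
  exact ⟨ω, hω, le_antisymm (ciSup_le fun x => hm x x.2) (le_ciSup hbdd ⟨ω, hω⟩),
    fun ω' hω' => le_ciSup hbdd ⟨ω', hω'⟩⟩

/-- For a stabilizing gain, the supremum in the `H∞` cost is an attained maximum. -/
theorem exists_hInfCost_eq {nx nu nw ny : ℕ} (A : Matrix (Fin nx) (Fin nx) ℝ)
    (B : Matrix (Fin nx) (Fin nu) ℝ) (Bw : Matrix (Fin nx) (Fin nw) ℝ)
    (C : Matrix (Fin ny) (Fin nx) ℝ) (Q : Matrix (Fin nx) (Fin nx) ℝ)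
    (R : Matrix (Fin nu) (Fin nu) ℝ) (K : Matrix (Fin nu) (Fin ny) ℝ)
    (hK : K ∈ stabilizingSet A B C) :
    ∃ ω ∈ Set.Icc (0 : ℝ) (2 * Real.pi),
      hInfCost A B Bw C Q R K = sigmaMax (closedLoopTransfer A B Bw C Q R K ω) ∧
      ∀ ω' ∈ Set.Icc (0 : ℝ) (2 * Real.pi),
        sigmaMax (closedLoopTransfer A B Bw C Q R K ω') ≤ hInfCost A B Bw C Q R K := by
  exact exists_iSup_Icc_eq (by positivity)
    (continuous_sigmaMax_closedLoopTransfer A B Bw C Q R K hK)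

/-!
A gain with `0 ∈ ∂J(K)` is a global minimizer because the `H∞` cost under full state feedback is
convex in hidden coordinates: the bounded real lemma describes `J(K) ≤ γ` by a matrix inequality
that is convex in `(P⁻¹, K P⁻¹)`. The proof turns this into a direction of descent.

Suppose `K` and `K₀` are stabilizing with `J(K₀) < γ₀ < γ = J(K)`. The bounded real lemma gives
storage matrices `P₀` for `K₀` at the level `γ₀` (`IsSchurStable.exists_isStorageMatrix_of_lt`) and
`P` for `K` at the level `γ` itself (`IsSchurStable.exists_isStorageMatrix`). The second needs a
compactness argument, which is where the full row rank of `B_w` enters. Both rest on the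
Kalman–Yakubovich–Popov lemma `Matrix.exists_dissipation_of_frequency_inequality`, proved by
separating convex sets and splitting the dual certificate with the spectral theorem for unitary
operators. Positive definiteness of `Q` and stability make `P₀` invertible.

The direction `V = (K₀ - K) P₀⁻¹ P` is the velocity at `K` of the curve in gain space that is a
segment from `K` to `K₀` in the hidden coordinates. The cost is the maximum of
`Re ⟨u, T(K, ω) v⟩` over frequencies `ω` and vectors `u`, `v` of norm at most `1`, and at each
maximizer the derivative along `V` is at most `-(γ² - γ₀²) / (2 γ)`: this is
`re_transferSlope_le`, an algebraic consequence (`descent_inequality`) of the two dissipation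
inequalities. A Danskin-type argument, `clarkeDirDeriv_lt_zero_of_isCompact`, then makes the Clarke
directional derivative of `J` along `V` negative, so `0` is not a Clarke subgradient.
It uses the resolvent identity, which expresses the difference quotients of the transfer
matrix by a jointly continuous function.

Conversely, the stabilizing set is open, so a global minimizer is a local minimizer, and there all
Clarke directional derivatives are nonnegative.
-/

/-! ### Schur stability -/

section Stability

attribute [local instance] Matrix.linftyOpNormedRing Matrix.linftyOpNormedAlgebra

theorem det_smul_one_sub_ne_zero {n : ℕ} {M : Matrix (Fin n) (Fin n) ℝ} (hM : IsSchurStable M)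
    {z : ℂ} (hz : ‖z‖ = 1) :
    (z • (1 : Matrix (Fin n) (Fin n) ℂ) - M.map Complex.ofReal).det ≠ 0 := by
  intro h0
  have hmem : z ∈ spectrum ℂ (M.map Complex.ofReal) := by
    rw [spectrum.mem_iff, Algebra.algebraMap_eq_smul_one, Matrix.isUnit_iff_isUnit_det, h0]
    simp
  have hle : (‖z‖₊ : ENNReal) ≤ spectralRadius ℂ (M.map Complex.ofReal) :=
    le_iSup₂ (f := fun k (_ : k ∈ spectrum ℂ (M.map Complex.ofReal)) => (‖k‖₊ : ENNReal)) _ hmem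
  have hone : ‖z‖₊ = 1 := by ext; simpa using hz
  rw [hone] at hle
  exact absurd (lt_of_le_of_lt hle hM) (by simp)

theorem isOpen_setOf_isSchurStable (n : ℕ) :
    IsOpen {M : Matrix (Fin n) (Fin n) ℝ | IsSchurStable M} := by
  rcases subsingleton_or_nontrivial (Matrix (Fin n) (Fin n) ℂ) with hs | hs
  · have : {M : Matrix (Fin n) (Fin n) ℝ | IsSchurStable M} = Set.univ := by
      ext M
      simp [IsSchurStable, spectrum.SpectralRadius.of_subsingleton]
    rw [this]
    exact isOpen_univ
  have hopen : IsOpen {N : Matrix (Fin n) (Fin n) ℂ | spectralRadius ℂ N < 1} := by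
    rw [isOpen_iff_mem_nhds]
    intro N hN
    have hball : Metric.ball (0 : ℂ) 1 ∈ 𝓝ˢ (spectrum ℂ N) := by
      refine Metric.isOpen_ball.mem_nhdsSet.2 fun k hk => ?_
      have : (‖k‖₊ : ENNReal) < 1 := lt_of_le_of_lt
        (le_iSup₂ (f := fun k (_ : k ∈ spectrum ℂ N) => (‖k‖₊ : ENNReal)) _ hk) hN
      simpa [← NNReal.coe_lt_coe] using this
    have := upperHemicontinuous_spectrum ℂ (Matrix (Fin n) (Fin n) ℂ)
    rw [upperHemicontinuous_iff] at this
    have h2 := upperHemicontinuousAt_iff.1 (this N) _ hball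
    filter_upwards [h2] with N' hN'
    have : spectralRadius ℂ N' < ((1 : NNReal) : ENNReal) := by
      refine spectrum.spectralRadius_lt_of_forall_lt N' fun k hk => ?_
      have := subset_of_mem_nhdsSet hN' hk
      simpa [← NNReal.coe_lt_coe] using this
    simpa using this
  exact hopen.preimage (continuous_id.matrix_map Complex.continuous_ofReal)

theorem isOpen_stabilizingSet {nx nu ny : ℕ} (A : Matrix (Fin nx) (Fin nx) ℝ)
    (B : Matrix (Fin nx) (Fin nu) ℝ) (C : Matrix (Fin ny) (Fin nx) ℝ) :
    IsOpen (stabilizingSet A B C) :=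
  (isOpen_setOf_isSchurStable nx).preimage (f := fun K => A + B * K * C) (by fun_prop)

theorem IsSchurStable.tendsto_pow {n : ℕ} {M : Matrix (Fin n) (Fin n) ℝ} (hM : IsSchurStable M) :
    Filter.Tendsto (fun k : ℕ => M ^ k) Filter.atTop (𝓝 0) := by
  set N := M.map Complex.ofReal with hN
  have hc : Filter.Tendsto (fun k : ℕ => N ^ k) Filter.atTop (𝓝 0) := by
    obtain ⟨r, hr1, hr2⟩ := ENNReal.lt_iff_exists_nnreal_btwn.1 hM
    have hr2' : r < 1 := by simpa using hr2
    have h1 := (spectrum.pow_nnnorm_pow_one_div_tendsto_nhds_spectralRadius N).eventually_lt_const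
      hr1
    refine tendsto_zero_iff_norm_tendsto_zero.2 (squeeze_zero'
      (Filter.Eventually.of_forall fun k => norm_nonneg _) ?_
      (tendsto_pow_atTop_nhds_zero_of_lt_one r.2 (by exact_mod_cast hr2')))
    filter_upwards [h1, Filter.eventually_gt_atTop 0] with k hk hk0
    have h2 : ((‖N ^ k‖₊ : ENNReal) ^ (1 / k : ℝ)) ^ (k : ℝ) ≤ (r : ENNReal) ^ (k : ℝ) :=
      ENNReal.rpow_le_rpow hk.le (by positivity)
    rw [← ENNReal.rpow_mul, one_div, inv_mul_cancel₀ (by positivity), ENNReal.rpow_one,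
      ENNReal.rpow_natCast] at h2
    exact_mod_cast h2
  have hre : Filter.Tendsto (fun k : ℕ => (N ^ k).map Complex.re) Filter.atTop
      (𝓝 ((0 : Matrix (Fin n) (Fin n) ℂ).map Complex.re)) :=
    ((continuous_id.matrix_map Complex.continuous_re).tendsto _).comp hc
  have h3 : ∀ k : ℕ, (N ^ k).map Complex.re = M ^ k := by
    intro k
    have : N ^ k = (M ^ k).map Complex.ofReal := by
      have := map_pow (Complex.ofRealHom.mapMatrix (m := Fin n)) M k
      exact this.symm
    rw [this]
    ext i j
    simp
  simp only [h3] at hre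
  convert hre using 2
  ext i j
  simp

end Stability

/-- A discrete Lyapunov inequality `Mᵀ P M - P + S ≤ 0` along a stable `M` with `S ≥ 0` forces
`P ≥ S`: the form `x ↦ xᵀ P x` is nonincreasing along the orbits of `M`, and these tend to `0`. -/
theorem IsSchurStable.le_of_lyapunov {n : ℕ} {M P S : Matrix (Fin n) (Fin n) ℝ}
    (hM : IsSchurStable M) (hS : ∀ x, 0 ≤ x ⬝ᵥ S *ᵥ x)
    (h : ∀ x, (M *ᵥ x) ⬝ᵥ P *ᵥ (M *ᵥ x) + x ⬝ᵥ S *ᵥ x ≤ x ⬝ᵥ P *ᵥ x) (x : Fin n → ℝ) :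
    x ⬝ᵥ S *ᵥ x ≤ x ⬝ᵥ P *ᵥ x := by
  have hnonneg : ∀ y, 0 ≤ y ⬝ᵥ P *ᵥ y := by
    intro y
    have hmono : ∀ k : ℕ, ((M ^ k) *ᵥ y) ⬝ᵥ P *ᵥ ((M ^ k) *ᵥ y) ≤ y ⬝ᵥ P *ᵥ y := by
      intro k
      induction k with
      | zero => simp
      | succ k ih =>
        rw [pow_succ', ← Matrix.mulVec_mulVec]
        linarith [h ((M ^ k) *ᵥ y), hS ((M ^ k) *ᵥ y)]
    have hcont : Continuous fun N : Matrix (Fin n) (Fin n) ℝ => (N *ᵥ y) ⬝ᵥ P *ᵥ (N *ᵥ y) := by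
      fun_prop
    have := (hcont.tendsto 0).comp hM.tendsto_pow
    simp only [Matrix.zero_mulVec, zero_dotProduct] at this
    exact le_of_tendsto this (Filter.Eventually.of_forall hmono)
  linarith [h x, hnonneg (M *ᵥ x)]

/-! ### Eigenbases of isometries -/

section Isometry

variable {E : Type*} [NormedAddCommGroup E] [InnerProductSpace ℂ E]

theorem LinearIsometry.norm_eigenvalue {L : E →ₗᵢ[ℂ] E} {μ : ℂ} {v : E} (hv : v ≠ 0)
    (h : L v = μ • v) : ‖μ‖ = 1 := by
  have := L.norm_map v
  rw [h, norm_smul] at this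
  have hv' : ‖v‖ ≠ 0 := norm_ne_zero_iff.2 hv
  exact mul_right_cancel₀ hv' (by linarith)

theorem LinearIsometry.orthogonalFamily_eigenspaces (L : E →ₗᵢ[ℂ] E) :
    OrthogonalFamily ℂ (fun μ => Module.End.eigenspace L.toLinearMap μ)
      fun μ => (Module.End.eigenspace L.toLinearMap μ).subtypeₗᵢ := by
  refine OrthogonalFamily.of_pairwise fun μ ν hμν v hv w hw => ?_
  have hv : L v = μ • v := by simpa using Module.End.mem_eigenspace_iff.1 hv
  have hw : L w = ν • w := by simpa using Module.End.mem_eigenspace_iff.1 hw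
  by_contra hne
  have hv0 : v ≠ 0 := by rintro rfl; simp at hne
  have h1 := L.inner_map_map w v
  have h1' := L.inner_map_map v w
  rw [hv, hw, inner_smul_left, inner_smul_right] at h1'
  have hμ := LinearIsometry.norm_eigenvalue hv0 hv
  have h2 : (starRingEnd ℂ) μ * μ = 1 := by rw [Complex.conj_mul', hμ]; simp
  have hne' : inner ℂ v w ≠ 0 := by
    intro h; exact hne (by first | exact h | (rw [← inner_conj_symm, h]; simp))
  have h3 : (starRingEnd ℂ) μ * ν = 1 := mul_right_cancel₀ hne' (by rw [one_mul, mul_assoc, h1'])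
  apply hμν
  have h4 : (starRingEnd ℂ) μ ≠ 0 := by rintro h; rw [h] at h2; simp at h2
  exact mul_left_cancel₀ h4 (by rw [h2, h3])

theorem LinearIsometry.iSup_eigenspace_eq_top [FiniteDimensional ℂ E] (L : E →ₗᵢ[ℂ] E) :
    ⨆ μ, Module.End.eigenspace L.toLinearMap μ = ⊤ := by
  set S := ⨆ μ, Module.End.eigenspace L.toLinearMap μ with hS
  rw [← Submodule.orthogonal_eq_bot_iff]
  by_contra hne
  have hinv : ∀ w ∈ Sᗮ, L.toLinearMap w ∈ Sᗮ := by
    intro w hw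
    rw [hS, ← Submodule.iInf_orthogonal, Submodule.mem_iInf] at hw ⊢
    intro μ v hv
    have hv' : L v = μ • v := by simpa using Module.End.mem_eigenspace_iff.1 hv
    by_cases hv0 : v = 0
    · simp [hv0]
    have hμ := LinearIsometry.norm_eigenvalue hv0 hv'
    have h1 := L.inner_map_map v w
    rw [hw μ v hv, hv', inner_smul_left] at h1
    have h4 : (starRingEnd ℂ) μ ≠ 0 := by
      intro h; rw [map_eq_zero] at h; rw [h] at hμ; simp at hμ
    simpa [h4] using h1
  have : Nontrivial Sᗮ := Submodule.nontrivial_iff_ne_bot.2 hne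
  obtain ⟨μ, hμ⟩ := Module.End.exists_eigenvalue (L.toLinearMap.restrict hinv)
  obtain ⟨v, hv⟩ := hμ.exists_hasEigenvector
  have hv1 := Module.End.mem_eigenspace_iff.1 hv.1
  have hv2 : (v : E) ∈ Module.End.eigenspace L.toLinearMap μ := by
    rw [Module.End.mem_eigenspace_iff]
    simpa using congrArg Subtype.val hv1
  have hvS : (v : E) ∈ S := (le_iSup (fun μ => Module.End.eigenspace L.toLinearMap μ) μ) hv2
  exact hv.2 (Subtype.ext (inner_self_eq_zero.1 (v.2 _ hvS)))

/-- Spectral theorem for unitary operators: a linear isometry of a finite-dimensional complex inner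
product space has an orthonormal eigenbasis. -/
theorem LinearIsometry.exists_eigenbasis [FiniteDimensional ℂ E] (L : E →ₗᵢ[ℂ] E) {n : ℕ}
    (hn : Module.finrank ℂ E = n) :
    ∃ (b : OrthonormalBasis (Fin n) ℂ E) (z : Fin n → ℂ),
      (∀ k, ‖z k‖ = 1) ∧ ∀ k, L (b k) = z k • b k := by
  classical
  let V := fun μ : Module.End.Eigenvalues L.toLinearMap =>
    Module.End.eigenspace L.toLinearMap (μ : ℂ)
  have horth : OrthogonalFamily ℂ (fun μ => V μ) fun μ => (V μ).subtypeₗᵢ :=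
    L.orthogonalFamily_eigenspaces.comp Subtype.coe_injective
  have hint : DirectSum.IsInternal V := by
    refine horth.isInternal_iff.2 ?_
    rw [Submodule.orthogonal_eq_bot_iff, eq_top_iff, ← L.iSup_eigenspace_eq_top]
    refine iSup_le fun μ => ?_
    by_cases hμ : Module.End.HasEigenvalue L.toLinearMap μ
    · exact le_iSup V ⟨μ, hμ⟩
    · rw [Module.End.hasEigenvalue_iff, not_not] at hμ
      rw [hμ]
      exact bot_le
  let b := hint.subordinateOrthonormalBasis hn horth
  have hb : ∀ k, ∃ z : ℂ, L (b k) = z • b k := fun k =>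
    ⟨_, Module.End.mem_eigenspace_iff.1
      (hint.subordinateOrthonormalBasis_subordinate hn k horth)⟩
  choose z hz using hb
  exact ⟨b, z, fun k => LinearIsometry.norm_eigenvalue (b.orthonormal.ne_zero k) (hz k), hz⟩

end Isometry

/-- If two linear maps into `E` have the same norms, they differ by a unitary of `E`; in an
eigenbasis of that unitary their adjoints are proportional with unimodular factors. -/
theorem exists_orthonormalBasis_adjoint_eq_smul {H E : Type*} [NormedAddCommGroup H]
    [InnerProductSpace ℂ H] [FiniteDimensional ℂ H] [NormedAddCommGroup E] [InnerProductSpace ℂ E]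
    [FiniteDimensional ℂ E] {f g : H →ₗ[ℂ] E} (h : ∀ x, ‖f x‖ = ‖g x‖) {n : ℕ}
    (hn : Module.finrank ℂ E = n) :
    ∃ (b : OrthonormalBasis (Fin n) ℂ E) (z : Fin n → ℂ),
      (∀ k, ‖z k‖ = 1) ∧ ∀ k, LinearMap.adjoint f (b k) = z k • LinearMap.adjoint g (b k) := by
  obtain ⟨σ, hσ⟩ := g.rangeRestrict.exists_rightInverse_of_surjective g.range_rangeRestrict
  have hσ' : ∀ s, g (σ s) = s := fun s => congrArg Subtype.val (LinearMap.congr_fun hσ s)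
  let L₀ : LinearMap.range g →ₗᵢ[ℂ] E :=
    { toLinearMap := f ∘ₗ σ
      norm_map' := fun s => by
        rw [LinearMap.comp_apply, h, hσ', Submodule.coe_norm] }
  let L := L₀.extend
  have hL : ∀ x, L (g x) = f x := by
    intro x
    have h1 : L (g x) = f (σ ⟨g x, LinearMap.mem_range_self g x⟩) :=
      L₀.extend_apply ⟨g x, LinearMap.mem_range_self g x⟩
    rw [h1, ← sub_eq_zero, ← map_sub, ← norm_eq_zero, h, map_sub, hσ', sub_self, norm_zero]
  obtain ⟨b, z, hz, hb⟩ := L.exists_eigenbasis hn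
  refine ⟨b, fun k => (z k)⁻¹, fun k => by rw [norm_inv, hz, inv_one], fun k => ?_⟩
  have hz0 : z k ≠ 0 := by
    intro h0
    have := hz k
    simp [h0] at this
  refine ext_inner_left ℂ fun x => ?_
  rw [LinearMap.adjoint_inner_right, inner_smul_right, LinearMap.adjoint_inner_right, ← hL x,
    ← L.inner_map_map (g x) (b k), hb, inner_smul_right, inv_mul_cancel_left₀ hz0]

namespace Matrix

theorem exists_mul_eq_mul_diagonal_of_mul_conjTranspose_eq {n ι : Type*} [Fintype n]
    [DecidableEq n] [Fintype ι] [DecidableEq ι] {M N : Matrix n ι ℂ} (h : M * Mᴴ = N * Nᴴ) :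
    ∃ (U : Matrix ι (Fin (Fintype.card ι)) ℂ) (z : Fin (Fintype.card ι) → ℂ),
      U * Uᴴ = 1 ∧ (∀ k, ‖z k‖ = 1) ∧ M * U = N * U * diagonal z := by
  have hnorm : ∀ (M : Matrix n ι ℂ) x, ((‖toEuclideanLin Mᴴ x‖ ^ 2 : ℝ) : ℂ) =
      inner ℂ x (toEuclideanLin (M * Mᴴ) x) := by
    intro M x
    rw [toLpLin_mul_same, LinearMap.comp_apply]
    rw [toEuclideanLin_conjTranspose_eq_adjoint, ← LinearMap.adjoint_inner_left,
      inner_self_eq_norm_sq_to_K]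
    simp
  have heq : ∀ x, ‖toEuclideanLin Mᴴ x‖ = ‖toEuclideanLin Nᴴ x‖ := by
    intro x
    have h1 := hnorm M x
    rw [h, ← hnorm N x] at h1
    exact (sq_eq_sq₀ (norm_nonneg _) (norm_nonneg _)).1 (by exact_mod_cast h1)
  obtain ⟨b, z, hz, hb⟩ := exists_orthonormalBasis_adjoint_eq_smul heq
    (finrank_euclideanSpace (𝕜 := ℂ) (ι := ι))
  refine ⟨of fun i k => b k i, z, ?_, hz, ?_⟩
  · have h1 := (EuclideanSpace.basisFun ι ℂ).toMatrix_orthonormalBasis_self_mul_conjTranspose b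
    have h2 : (of fun i k => b k i) = (EuclideanSpace.basisFun ι ℂ).toBasis.toMatrix b := by
      ext i k
      simp [Module.Basis.toMatrix_apply]
    rw [h2, h1]
  · ext i k
    have h1 := congrArg (fun v => v i) (hb k)
    simp only [← toEuclideanLin_conjTranspose_eq_adjoint, conjTranspose_conjTranspose] at h1
    rw [mul_diagonal]
    simpa [mul_apply, toLpLin_apply, mulVec, dotProduct, mul_comm] using h1

end Matrix

/-! ### The Kalman–Yakubovich–Popov lemma -/

namespace Matrix

variable {l m n p : Type*}

theorem map_ofReal_mul [Fintype m] (M : Matrix l m ℝ) (N : Matrix m n ℝ) :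
    (M * N).map Complex.ofReal = M.map Complex.ofReal * N.map Complex.ofReal :=
  Matrix.map_mul (f := Complex.ofRealHom)

theorem map_ofReal_add (M N : Matrix m n ℝ) :
    (M + N).map Complex.ofReal = M.map Complex.ofReal + N.map Complex.ofReal := by
  ext; simp

theorem map_ofReal_sub (M N : Matrix m n ℝ) :
    (M - N).map Complex.ofReal = M.map Complex.ofReal - N.map Complex.ofReal := by
  ext; simp

theorem map_ofReal_neg (M : Matrix m n ℝ) :
    (-M).map Complex.ofReal = -M.map Complex.ofReal := by
  ext; simp

theorem conjTranspose_map_ofReal (M : Matrix m n ℝ) :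
    (M.map Complex.ofReal)ᴴ = Mᵀ.map Complex.ofReal := by
  ext; simp

theorem trace_map_ofReal [Fintype n] (M : Matrix n n ℝ) :
    (M.map Complex.ofReal).trace = (M.trace : ℂ) := by
  simp [trace]

theorem trace_transpose_mul_mul_mul_eq [Fintype n] [Fintype p] (W : Matrix p p ℝ)
    (F : Matrix n p ℝ) (P : Matrix n n ℝ) :
    (Wᵀ * (Fᵀ * P * F)).trace = (F * Wᵀ * Fᵀ * P).trace := by
  rw [Matrix.mul_assoc F, Matrix.mul_assoc F, trace_mul_comm F]
  simp only [Matrix.mul_assoc]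

theorem PosSemidef.transpose_sqrt_mul_sqrt [Fintype n] [DecidableEq n] {Q : Matrix n n ℝ}
    (hQ : Q.PosSemidef) : (CFC.sqrt Q)ᵀ * CFC.sqrt Q = Q := by
  have h1 : (CFC.sqrt Q).PosSemidef := nonneg_iff_posSemidef.1 (CFC.sqrt_nonneg Q)
  rw [← conjTranspose_eq_transpose_of_trivial, h1.isHermitian.eq]
  exact CFC.sqrt_mul_sqrt_self Q (nonneg_iff_posSemidef.2 hQ)

theorem isOpen_setOf_forall_dotProduct_mulVec_neg [Fintype p] :
    IsOpen {N : Matrix p p ℝ | ∀ x, x ≠ 0 → x ⬝ᵥ N *ᵥ x < 0} := by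
  rw [isOpen_iff_mem_nhds]
  intro N hN
  have hcont : Continuous fun q : Matrix p p ℝ × (p → ℝ) => q.2 ⬝ᵥ q.1 *ᵥ q.2 := by fun_prop
  have h1 : ∀ᶠ N' in 𝓝 N, ∀ x ∈ Metric.sphere (0 : p → ℝ) 1, x ⬝ᵥ N' *ᵥ x < 0 := by
    refine (isCompact_sphere _ _).eventually_forall_of_forall_eventually fun x hx => ?_
    have hx0 : x ≠ 0 := by rintro rfl; simp at hx
    exact hcont.continuousAt.eventually_lt_const (hN x hx0)
  filter_upwards [h1] with N' hN' x hx
  have hx' : 0 < ‖x‖ := norm_pos_iff.2 hx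
  have h2 := hN' (‖x‖⁻¹ • x) (by simp [norm_smul, hx'.ne'])
  rw [mulVec_smul, dotProduct_smul, smul_dotProduct, smul_eq_mul, smul_eq_mul] at h2
  by_contra h3
  push Not at h3
  have : 0 ≤ ‖x‖⁻¹ * (‖x‖⁻¹ * x ⬝ᵥ N' *ᵥ x) := by positivity
  linarith

/-- Kalman–Yakubovich–Popov lemma in Rantzer's formulation. If no linear matrix inequality
certificate `P` exists, a separating functional is a positive semidefinite `W ≠ 0` with
`F W Fᵀ = G W Gᵀ` and `Tr (W Θ) ≥ 0`. Factoring `W = Z Zᵀ`, the two factors `F Z` and `G Z` agree up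
to a unitary, whose eigenbasis splits `W` into rank-one terms `ζ ζᴴ` with `F ζ = z G ζ`, `‖z‖ = 1`;
one of these violates the frequency-domain inequality. -/
theorem exists_dissipation_of_frequency_inequality [Fintype n] [DecidableEq n] [Fintype p]
    [DecidableEq p] (F G : Matrix n p ℝ) {Θ : Matrix p p ℝ} (hΘ : Θᵀ = Θ)
    (h : ∀ (z : ℂ) (ζ : p → ℂ), ‖z‖ = 1 → ζ ≠ 0 →
      F.map Complex.ofReal *ᵥ ζ = z • (G.map Complex.ofReal *ᵥ ζ) →
      (star ζ ⬝ᵥ Θ.map Complex.ofReal *ᵥ ζ).re < 0) :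
    ∃ P : Matrix n n ℝ, ∀ ζ : p → ℝ,
      (F *ᵥ ζ) ⬝ᵥ P *ᵥ (F *ᵥ ζ) - (G *ᵥ ζ) ⬝ᵥ P *ᵥ (G *ᵥ ζ) + ζ ⬝ᵥ Θ *ᵥ ζ ≤ 0 := by
  by_contra hcon
  push Not at hcon
  let Neg : Set (Matrix p p ℝ) := {N | ∀ x, x ≠ 0 → x ⬝ᵥ N *ᵥ x < 0}
  let Aff : Set (Matrix p p ℝ) := {N | ∃ P : Matrix n n ℝ, N = Fᵀ * P * F - Gᵀ * P * G + Θ}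
  have hNeg : Convex ℝ Neg := by
    refine convex_iff_forall_pos.2 fun M hM N hN a b ha hb _ x hx => ?_
    rw [add_mulVec, dotProduct_add, smul_mulVec, smul_mulVec, dotProduct_smul, dotProduct_smul,
      smul_eq_mul, smul_eq_mul]
    nlinarith [hM x hx, hN x hx, mul_pos ha (neg_pos.2 (hM x hx)),
      mul_pos hb (neg_pos.2 (hN x hx))]
  have hAff : Convex ℝ Aff := by
    rintro _ ⟨P, rfl⟩ _ ⟨P', rfl⟩ a b _ _ hab
    refine ⟨a • P + b • P', ?_⟩
    have : Θ = a • Θ + b • Θ := by rw [← add_smul, hab, one_smul]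
    conv_rhs => rw [this]
    simp only [Matrix.mul_add, Matrix.add_mul, Matrix.mul_smul, Matrix.smul_mul, smul_add, smul_sub]
    abel
  have hdisj : Disjoint Neg Aff := by
    rw [Set.disjoint_left]
    rintro _ hN ⟨P, rfl⟩
    obtain ⟨ζ, hζ⟩ := hcon P
    have hζ0 : ζ ≠ 0 := by rintro rfl; simp at hζ
    have h1 := hN ζ hζ0
    simp only [add_mulVec, sub_mulVec, dotProduct_add, dotProduct_sub, ← mulVec_mulVec,
      dotProduct_mulVec _ Fᵀ, dotProduct_mulVec _ Gᵀ, vecMul_transpose] at h1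
    linarith
  obtain ⟨f, s, hfN, hfA⟩ := geometric_hahn_banach_open hNeg
    isOpen_setOf_forall_dotProduct_mulVec_neg hAff hdisj
  have hone : (-1 : Matrix p p ℝ) ∈ Neg := by
    intro x hx
    rw [neg_mulVec, one_mulVec, dotProduct_neg, neg_lt_zero]
    exact lt_of_le_of_ne (Finset.sum_nonneg fun i _ => mul_self_nonneg (x i))
      (Ne.symm (by simpa using hx))
  -- The values of the functional on the cone and on the affine subspace.
  have hs : 0 ≤ s := by
    by_contra! hs
    have hε : 0 < -s / (|f (-1)| + 1) := div_pos (by linarith) (by positivity)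
    have h1 := hfN ((-s / (|f (-1)| + 1)) • (-1)) fun x hx => by
      rw [smul_mulVec, dotProduct_smul, smul_eq_mul]
      exact mul_neg_of_pos_of_neg hε (hone x hx)
    rw [map_smul, smul_eq_mul] at h1
    have h2 : -s / (|f (-1)| + 1) * (|f (-1)| + 1) = -s := by field_simp
    nlinarith [neg_abs_le (f (-1))]
  have hcone : ∀ N : Matrix p p ℝ, (∀ x, x ⬝ᵥ N *ᵥ x ≤ 0) → f N ≤ 0 := by
    intro N hN
    by_contra! hf
    have ht : 0 ≤ |s - f (-1)| / f N := by positivity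
    have h1 := hfN ((|s - f (-1)| / f N) • N + (-1)) fun x hx => by
      rw [add_mulVec, dotProduct_add, smul_mulVec, dotProduct_smul, smul_eq_mul]
      nlinarith [hone x hx, mul_nonneg ht (neg_nonneg.2 (hN x))]
    rw [map_add, map_smul, smul_eq_mul, div_mul_cancel₀ _ hf.ne'] at h1
    linarith [le_abs_self (s - f (-1))]
  have hlin : ∀ P : Matrix n n ℝ, f (Fᵀ * P * F - Gᵀ * P * G) = 0 := by
    intro P
    by_contra hf
    set a := f (Fᵀ * P * F - Gᵀ * P * G) with ha
    have h1 := hfA (Fᵀ * ((-(f Θ - s + 1) / a) • P) * F - Gᵀ * ((-(f Θ - s + 1) / a) • P) * G + Θ)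
      ⟨_, rfl⟩
    rw [Matrix.mul_smul, Matrix.mul_smul, Matrix.smul_mul, Matrix.smul_mul, ← smul_sub, map_add,
      map_smul, smul_eq_mul, ← ha, div_mul_cancel₀ _ hf] at h1
    linarith
  have hfΘ : s ≤ f Θ := hfA _ ⟨0, by simp⟩
  let W : Matrix p p ℝ := of fun i j => f (single i j 1)
  have hfW : ∀ N, f N = (Wᵀ * N).trace := by
    intro N
    conv_lhs => rw [matrix_eq_sum_single N]
    simp only [map_sum, trace, diag_apply, mul_apply, transpose_apply, W, of_apply]
    rw [Finset.sum_comm]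
    refine Finset.sum_congr rfl fun j _ => Finset.sum_congr rfl fun i _ => ?_
    have : single i j (N i j) = N i j • single i j (1 : ℝ) := by simp [smul_single]
    rw [this, map_smul, smul_eq_mul, mul_comm]
  have hFG : F * Wᵀ * Fᵀ = G * Wᵀ * Gᵀ := by
    rw [ext_iff_trace_mul_right]
    intro P
    have h1 := hlin P
    rw [hfW, Matrix.mul_sub, trace_sub, trace_transpose_mul_mul_mul_eq,
      trace_transpose_mul_mul_mul_eq, sub_eq_zero] at h1
    exact h1
  have hFG' : F * W * Fᵀ = G * W * Gᵀ := by
    have := congrArg transpose hFG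
    simpa [Matrix.mul_assoc] using this
  have hpsd : (W + Wᵀ).PosSemidef := by
    refine PosSemidef.of_dotProduct_mulVec_nonneg ?_ fun x => ?_
    · rw [IsHermitian, conjTranspose_eq_transpose_of_trivial, transpose_add, transpose_transpose,
        add_comm]
    · have h1 := hcone (-vecMulVec x x) fun y => by
        rw [neg_mulVec, dotProduct_neg, vecMulVec_mulVec, dotProduct_smul]
        simp [dotProduct_comm y x, mul_self_nonneg]
      have h2 : f (vecMulVec x x) = x ⬝ᵥ W *ᵥ x := by
        rw [hfW, mul_vecMulVec, trace_vecMulVec, mulVec_transpose, dotProduct_comm,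
          dotProduct_mulVec, dotProduct_comm]
      have h3 : x ⬝ᵥ Wᵀ *ᵥ x = x ⬝ᵥ W *ᵥ x := by
        rw [mulVec_transpose, dotProduct_comm, dotProduct_mulVec]
      rw [map_neg, h2] at h1
      rw [star_trivial, add_mulVec, dotProduct_add, h3]
      linarith
  obtain ⟨Y, hY⟩ : ∃ Y : Matrix p p ℝ, W + Wᵀ = Yᵀ * Y :=
    ⟨_, hpsd.transpose_sqrt_mul_sqrt.symm⟩
  have htrace : ((W + Wᵀ) * Θ).trace = 2 * f Θ := by
    have h1 : (W * Θ).trace = (Wᵀ * Θ).trace := by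
      rw [← trace_transpose, transpose_mul, hΘ, trace_mul_comm]
    rw [Matrix.add_mul, trace_add, h1, ← hfW]
    ring
  have hne : Yᵀ ≠ 0 := by
    intro h0
    rw [h0, Matrix.zero_mul] at hY
    rw [hY, Matrix.zero_mul, trace_zero] at htrace
    have h1 := congrArg trace hY
    rw [trace_add, trace_transpose, trace_zero] at h1
    have h2 := hfN _ hone
    rw [hfW, Matrix.mul_neg, Matrix.mul_one, trace_neg, trace_transpose] at h2
    linarith
  -- The two factors of `F W Fᵀ = G W Gᵀ`, over `ℂ`.
  set Z : Matrix p p ℂ := Yᵀ.map Complex.ofReal with hZ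
  have hfac : ∀ F : Matrix n p ℝ, (F.map Complex.ofReal * Z) * (F.map Complex.ofReal * Z)ᴴ =
      (F * W * Fᵀ + F * Wᵀ * Fᵀ).map Complex.ofReal := by
    intro F
    rw [← Matrix.add_mul, ← Matrix.mul_add, hY, conjTranspose_mul, hZ, conjTranspose_map_ofReal,
      conjTranspose_map_ofReal, transpose_transpose]
    simp only [map_ofReal_mul, Matrix.mul_assoc]
  obtain ⟨U, z, hU, hz, hUz⟩ := exists_mul_eq_mul_diagonal_of_mul_conjTranspose_eq
    ((hfac F).trans ((by rw [hFG, hFG'] : _ = _).trans (hfac G).symm))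
  have hcol : ∀ k, F.map Complex.ofReal *ᵥ (fun i => (Z * U) i k) =
      z k • (G.map Complex.ofReal *ᵥ fun i => (Z * U) i k) := by
    intro k
    ext i
    have h1 := congrFun (congrFun hUz i) k
    rw [mul_diagonal, Matrix.mul_assoc, Matrix.mul_assoc, mul_apply, mul_apply] at h1
    rw [Pi.smul_apply, smul_eq_mul, mul_comm]
    exact h1
  have hle : ∀ k, (star (fun i => (Z * U) i k) ⬝ᵥ
      Θ.map Complex.ofReal *ᵥ fun i => (Z * U) i k).re ≤ 0 := by
    intro k
    by_cases h0 : (fun i => (Z * U) i k) = 0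
    · simp [h0]
    · exact (h (z k) _ (hz k) h0 (hcol k)).le
  have hsum : (∑ k, (star (fun i => (Z * U) i k) ⬝ᵥ
      Θ.map Complex.ofReal *ᵥ fun i => (Z * U) i k).re) = 2 * f Θ := by
    have h1 : ((Z * U)ᴴ * (Θ.map Complex.ofReal * (Z * U))).trace = ((2 * f Θ : ℝ) : ℂ) := by
      rw [trace_mul_comm, conjTranspose_mul, ← Matrix.mul_assoc, Matrix.mul_assoc _ (Z * U),
        Matrix.mul_assoc Z, hU, Matrix.mul_one, Matrix.mul_assoc, trace_mul_comm, ← htrace, hY,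
        ← trace_map_ofReal, map_ofReal_mul, map_ofReal_mul, hZ, conjTranspose_map_ofReal,
        transpose_transpose]
    have h2 := congrArg Complex.re h1
    rw [Complex.ofReal_re] at h2
    rw [← h2, trace, Complex.re_sum]
    rfl
  have hzero : ∀ k, (fun i => (Z * U) i k) = 0 := by
    intro k
    by_contra h0
    have h1 := h (z k) _ (hz k) h0 (hcol k)
    have h2 := Finset.sum_lt_sum (fun k _ => hle k) ⟨k, Finset.mem_univ k, h1⟩
    rw [hsum, Finset.sum_const_zero] at h2
    linarith
  have hZU : Z * U = 0 := by
    ext i k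
    exact congrFun (hzero k) i
  have hZ0 : Z = 0 := by
    rw [← Matrix.mul_one Z, ← hU, ← Matrix.mul_assoc, hZU, Matrix.zero_mul]
  refine hne ?_
  ext i j
  simpa [hZ] using congrFun (congrFun hZ0 i) j

end Matrix

/-! ### Storage matrices and the bounded real lemma -/

section

open Matrix

open scoped ComplexOrder

theorem Matrix.PosSemidef.map_ofReal {n : Type*} [Fintype n] [DecidableEq n] {Q : Matrix n n ℝ}
    (hQ : Q.PosSemidef) : (Q.map Complex.ofReal).PosSemidef := by
  rw [← hQ.transpose_sqrt_mul_sqrt, map_ofReal_mul, ← conjTranspose_map_ofReal]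
  exact posSemidef_conjTranspose_mul_self _

section Dissipation

variable {R n m : Type*} [CommRing R] [StarRing R] [Fintype n] [Fintype m] [DecidableEq m]

/-- The matrix of the quadratic form
`(x, w) ↦ xᴴ P x + g wᴴ w - qᴴ P q - xᴴ S x`, `q = M x + G w`. It is positive semidefinite when
`xᴴ P x` is a storage function showing that the system `x⁺ = M x + G w` dissipates the supply rate
`g |w|² - xᴴ S x`. -/
def dissipationMatrix (M : Matrix n n R) (G : Matrix n m R) (S : Matrix n n R) (g : R)
    (P : Matrix n n R) : Matrix (n ⊕ m) (n ⊕ m) R :=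
  fromBlocks (P - Mᴴ * P * M - S) (-(Mᴴ * P * G)) (-(Gᴴ * P * M)) (g • 1 - Gᴴ * P * G)

theorem dissipationMatrix_mulVec (M : Matrix n n R) (G : Matrix n m R) (S : Matrix n n R) (g : R)
    (P : Matrix n n R) (x : n → R) (w : m → R) :
    dissipationMatrix M G S g P *ᵥ Sum.elim x w =
      Sum.elim (P *ᵥ x - Mᴴ *ᵥ P *ᵥ (M *ᵥ x + G *ᵥ w) - S *ᵥ x)
        (g • w - Gᴴ *ᵥ P *ᵥ (M *ᵥ x + G *ᵥ w)) := by
  rw [dissipationMatrix, fromBlocks_mulVec]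
  congr 1
  · simp only [Sum.elim_comp_inl, Sum.elim_comp_inr, sub_mulVec, neg_mulVec, mulVec_add,
      ← mulVec_mulVec]
    abel
  · simp only [Sum.elim_comp_inl, Sum.elim_comp_inr, sub_mulVec, neg_mulVec, mulVec_add,
      ← mulVec_mulVec, smul_mulVec, one_mulVec]
    abel

theorem star_mulVec_dotProduct {l : Type*} [Fintype l] (M : Matrix l n R) (x : n → R)
    (y : l → R) : star (M *ᵥ x) ⬝ᵥ y = star x ⬝ᵥ Mᴴ *ᵥ y := by
  rw [star_mulVec, ← dotProduct_mulVec]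

theorem dotProduct_dissipationMatrix_mulVec (M : Matrix n n R) (G : Matrix n m R)
    (S : Matrix n n R) (g : R) (P : Matrix n n R) (x : n → R) (w : m → R) :
    star (Sum.elim x w) ⬝ᵥ dissipationMatrix M G S g P *ᵥ Sum.elim x w =
      star x ⬝ᵥ P *ᵥ x + g * (star w ⬝ᵥ w) -
        star (M *ᵥ x + G *ᵥ w) ⬝ᵥ P *ᵥ (M *ᵥ x + G *ᵥ w) - star x ⬝ᵥ S *ᵥ x := by
  have hstar : star (Sum.elim x w) = Sum.elim (star x) (star w) := by
    ext i; cases i <;> rfl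
  rw [dissipationMatrix_mulVec, hstar, sumElim_dotProduct_sumElim, star_add, add_dotProduct,
    star_mulVec_dotProduct, star_mulVec_dotProduct]
  simp only [dotProduct_sub, dotProduct_smul, smul_eq_mul]
  ring

end Dissipation

theorem map_ofReal_dissipationMatrix {n m : Type*} [Fintype n] [Fintype m] [DecidableEq m]
    (M : Matrix n n ℝ) (G : Matrix n m ℝ) (S : Matrix n n ℝ) (g : ℝ) (P : Matrix n n ℝ) :
    (dissipationMatrix M G S g P).map Complex.ofReal =
      dissipationMatrix (M.map Complex.ofReal) (G.map Complex.ofReal) (S.map Complex.ofReal) (g : ℂ)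
        (P.map Complex.ofReal) := by
  have hone : (g • (1 : Matrix m m ℝ)).map Complex.ofReal = (g : ℂ) • 1 := by
    ext i j
    by_cases h : i = j <;> simp [h]
  simp only [dissipationMatrix, fromBlocks_map, map_ofReal_neg, map_ofReal_sub, map_ofReal_mul,
    hone, conjTranspose_map_ofReal, conjTranspose_eq_transpose_of_trivial]

/-- `P` is the matrix of a quadratic storage function certifying the gain bound `γ` for the system
`x⁺ = M x + G w` with output energy `xᵀ S x`. -/
def IsStorageMatrix {n m : ℕ} (M : Matrix (Fin n) (Fin n) ℝ) (G : Matrix (Fin n) (Fin m) ℝ)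
    (S : Matrix (Fin n) (Fin n) ℝ) (γ : ℝ) (P : Matrix (Fin n) (Fin n) ℝ) : Prop :=
  Pᵀ = P ∧ (dissipationMatrix M G S (γ ^ 2) P).PosSemidef

section BoundedReal

variable {n m : ℕ} {M : Matrix (Fin n) (Fin n) ℝ} {G : Matrix (Fin n) (Fin m) ℝ}
  {S : Matrix (Fin n) (Fin n) ℝ} {γ : ℝ}

theorem isStorageMatrix_iff (hS : Sᵀ = S) {P : Matrix (Fin n) (Fin n) ℝ} :
    IsStorageMatrix M G S γ P ↔ Pᵀ = P ∧ ∀ x w,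
      (M *ᵥ x + G *ᵥ w) ⬝ᵥ P *ᵥ (M *ᵥ x + G *ᵥ w) + x ⬝ᵥ S *ᵥ x ≤
        x ⬝ᵥ P *ᵥ x + γ ^ 2 * (w ⬝ᵥ w) := by
  refine and_congr_right fun hP => ?_
  have hherm : (dissipationMatrix M G S (γ ^ 2) P).IsHermitian := by
    simp only [dissipationMatrix, IsHermitian, fromBlocks_transpose,
      conjTranspose_eq_transpose_of_trivial, transpose_sub, transpose_neg, transpose_mul,
      transpose_transpose, transpose_smul, transpose_one, hP, hS, Matrix.mul_assoc]
  constructor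
  · intro h x w
    have h1 := h.dotProduct_mulVec_nonneg (Sum.elim x w)
    rw [dotProduct_dissipationMatrix_mulVec] at h1
    simp only [star_trivial] at h1
    linarith
  · intro h
    refine PosSemidef.of_dotProduct_mulVec_nonneg hherm fun ζ => ?_
    obtain ⟨x, w, rfl⟩ : ∃ x w, ζ = Sum.elim x w :=
      ⟨ζ ∘ Sum.inl, ζ ∘ Sum.inr, (Sum.elim_comp_inl_inr ζ).symm⟩
    rw [dotProduct_dissipationMatrix_mulVec]
    simp only [star_trivial]
    linarith [h x w]

/-- Strict bounded real lemma: a stable system whose frequency response has gain at most `j`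
has a storage function for every gain `γ > j`. -/
theorem IsSchurStable.exists_isStorageMatrix_of_lt (hM : IsSchurStable M) (hS : Sᵀ = S) {j : ℝ}
    (hj : 0 ≤ j) (hjγ : j < γ)
    (hfreq : ∀ (z : ℂ) (x : Fin n → ℂ) (w : Fin m → ℂ), ‖z‖ = 1 →
      M.map Complex.ofReal *ᵥ x + G.map Complex.ofReal *ᵥ w = z • x →
      (star x ⬝ᵥ S.map Complex.ofReal *ᵥ x).re ≤ j ^ 2 * (star w ⬝ᵥ w).re) :
    ∃ P, IsStorageMatrix M G S γ P := by
  have hΘ : (fromBlocks S 0 0 (-(γ ^ 2) • (1 : Matrix (Fin m) (Fin m) ℝ)))ᵀ =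
      fromBlocks S 0 0 (-(γ ^ 2) • (1 : Matrix (Fin m) (Fin m) ℝ)) := by
    simp [fromBlocks_transpose, hS]
  have hstrict : ∀ (z : ℂ) (ζ : Fin n ⊕ Fin m → ℂ), ‖z‖ = 1 → ζ ≠ 0 →
      (fromCols M G).map Complex.ofReal *ᵥ ζ = z • ((fromCols (1 : Matrix (Fin n) (Fin n) ℝ)
        (0 : Matrix (Fin n) (Fin m) ℝ)).map Complex.ofReal *ᵥ ζ) →
      (star ζ ⬝ᵥ (fromBlocks S 0 0 (-(γ ^ 2) • (1 : Matrix (Fin m) (Fin m) ℝ))).map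
        Complex.ofReal *ᵥ ζ).re < 0 := by
    intro z ζ hz hζ h
    obtain ⟨x, w, rfl⟩ : ∃ x w, ζ = Sum.elim x w :=
      ⟨ζ ∘ Sum.inl, ζ ∘ Sum.inr, (Sum.elim_comp_inl_inr ζ).symm⟩
    have hF : (fromCols M G).map Complex.ofReal =
        fromCols (M.map Complex.ofReal) (G.map Complex.ofReal) := by
      ext i k; cases k <;> rfl
    have hG : (fromCols (1 : Matrix (Fin n) (Fin n) ℝ) (0 : Matrix (Fin n) (Fin m) ℝ)).map
        Complex.ofReal = fromCols (1 : Matrix (Fin n) (Fin n) ℂ) 0 := by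
      ext i k
      cases k with
      | inl k => by_cases h : i = k <;> simp [h, one_apply]
      | inr k => simp
    have hT : (fromBlocks S 0 0 (-(γ ^ 2) • (1 : Matrix (Fin m) (Fin m) ℝ))).map Complex.ofReal =
        fromBlocks (S.map Complex.ofReal) 0 0 (((-(γ ^ 2) : ℝ) : ℂ) • 1) := by
      ext i k
      rcases i with i | i <;> rcases k with k | k <;>
        simp [one_apply, apply_ite Complex.ofReal]
    have hstar : star (Sum.elim x w) = Sum.elim (star x) (star w) := by
      ext i; cases i <;> rfl
    rw [hF, hG] at h
    simp only [fromCols_mulVec_sumElim, one_mulVec, zero_mulVec, add_zero] at h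
    have h1 := hfreq z x w hz h
    rw [hT, hstar]
    simp only [fromBlocks_mulVec, Sum.elim_comp_inl, Sum.elim_comp_inr,
        sumElim_dotProduct_sumElim, one_mulVec, zero_mulVec, add_zero, zero_add, smul_mulVec,
        dotProduct_smul, smul_eq_mul, Complex.add_re, Complex.re_ofReal_mul]
    have hw0 : w ≠ 0 := by
      rintro rfl
      apply hζ
      have hx : (z • (1 : Matrix (Fin n) (Fin n) ℂ) - M.map Complex.ofReal) *ᵥ x = 0 := by
        rw [sub_mulVec, smul_mulVec, one_mulVec, ← h, mulVec_zero, add_zero, sub_self]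
      have hx0 : x = 0 := by
        by_contra hx0
        exact det_smul_one_sub_ne_zero hM hz (exists_mulVec_eq_zero_iff.1 ⟨x, hx0, hx⟩)
      rw [hx0]
      ext i; cases i <;> rfl
    have hw : 0 < (star w ⬝ᵥ w).re := by
      have := dotProduct_star_self_pos_iff.2 hw0
      simpa using (Complex.lt_def.1 this).1
    nlinarith [mul_pos (sub_pos.2 (pow_lt_pow_left₀ hjγ hj two_ne_zero)) hw]
  obtain ⟨P, hP⟩ := exists_dissipation_of_frequency_inequality _ _ hΘ hstrict
  refine ⟨(1 / 2 : ℝ) • (P + Pᵀ), (isStorageMatrix_iff hS).2 ⟨?_, fun x w => ?_⟩⟩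
  · rw [transpose_smul, transpose_add, transpose_transpose, add_comm]
  · have hsymm : ∀ y : Fin n → ℝ, y ⬝ᵥ ((1 / 2 : ℝ) • (P + Pᵀ)) *ᵥ y = y ⬝ᵥ P *ᵥ y := by
      intro y
      have h3 : y ⬝ᵥ Pᵀ *ᵥ y = y ⬝ᵥ P *ᵥ y := by
        rw [mulVec_transpose, dotProduct_comm, dotProduct_mulVec]
      rw [smul_mulVec, dotProduct_smul, add_mulVec, dotProduct_add, h3, smul_eq_mul]
      ring
    have h1 := hP (Sum.elim x w)
    simp only [fromCols_mulVec_sumElim, fromBlocks_mulVec, Sum.elim_comp_inl, Sum.elim_comp_inr,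
      sumElim_dotProduct_sumElim, one_mulVec, zero_mulVec, add_zero, zero_add, smul_mulVec,
      dotProduct_smul, smul_eq_mul] at h1
    rw [hsymm, hsymm]
    linarith

theorem IsStorageMatrix.le (hM : IsSchurStable M) (hS : S.PosSemidef)
    {P : Matrix (Fin n) (Fin n) ℝ} (hP : IsStorageMatrix M G S γ P) (x : Fin n → ℝ) :
    x ⬝ᵥ S *ᵥ x ≤ x ⬝ᵥ P *ᵥ x := by
  have hS' : Sᵀ = S := by simpa using hS.isHermitian.eq
  refine hM.le_of_lyapunov (fun y => by simpa using hS.dotProduct_mulVec_nonneg y) (fun y => ?_) x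
  simpa using ((isStorageMatrix_iff hS').1 hP).2 y 0

/-- When the input matrix has a right inverse, storage matrices are entrywise bounded: from the
state `0` every state `x` is reached in one step at the cost of the supply `γ² |N x|²`. -/
theorem IsStorageMatrix.abs_apply_le (hM : IsSchurStable M) (hS : S.PosSemidef)
    {N : Matrix (Fin m) (Fin n) ℝ} (hN : G * N = 1) {P : Matrix (Fin n) (Fin n) ℝ}
    (hP : IsStorageMatrix M G S γ P) (i j : Fin n) :
    |P i j| ≤ γ ^ 2 * ((N.col i ⬝ᵥ N.col i) + (N.col j ⬝ᵥ N.col j)) := by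
  have hS' : Sᵀ = S := by simpa using hS.isHermitian.eq
  have h0 : ∀ x, 0 ≤ x ⬝ᵥ P *ᵥ x := fun x =>
    le_trans (by simpa using hS.dotProduct_mulVec_nonneg x) (hP.le hM hS x)
  have hii : ∀ i, P i i ≤ γ ^ 2 * (N.col i ⬝ᵥ N.col i) := by
    intro i
    have h1 := ((isStorageMatrix_iff hS').1 hP).2 0 (N.col i)
    have h2 : G *ᵥ N.col i = Pi.single i 1 := by
      rw [← mulVec_single_one, mulVec_mulVec, hN, one_mulVec]
    simpa [h2] using h1
  have hsymm : P j i = P i j := congrFun (congrFun hP.1 i) j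
  have hadd := h0 (Pi.single i 1 + Pi.single j 1)
  have hsub := h0 (Pi.single i 1 - Pi.single j 1)
  simp only [mulVec_add, mulVec_sub, dotProduct_add, dotProduct_sub, add_dotProduct,
    sub_dotProduct, mulVec_single_one, single_one_dotProduct, col_apply, hsymm] at hadd hsub
  have hi := hii i
  have hj := hii j
  have hi0 := h0 (Pi.single i 1)
  have hj0 := h0 (Pi.single j 1)
  simp only [mulVec_single_one, single_one_dotProduct, col_apply] at hi0 hj0
  rw [abs_le]
  constructor <;> nlinarith

theorem isClosed_setOf_isStorageMatrix (hS : Sᵀ = S) :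
    IsClosed {P | IsStorageMatrix M G S γ P} := by
  simp only [isStorageMatrix_iff hS, Set.ofPred_and, Set.ofPred_forall]
  refine (isClosed_eq (by fun_prop) (by fun_prop)).inter ?_
  exact isClosed_iInter fun x => isClosed_iInter fun w => isClosed_le (by fun_prop) (by fun_prop)

/-- Nonstrict bounded real lemma: with a right invertible input matrix, storage functions at the
gains `j + 1 / (k + 1)` stay in a compact set, and a limit is a storage function at `j`. -/
theorem IsSchurStable.exists_isStorageMatrix (hM : IsSchurStable M) (hS : S.PosSemidef)
    {N : Matrix (Fin m) (Fin n) ℝ} (hN : G * N = 1) {j : ℝ} (hj : 0 ≤ j)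
    (hfreq : ∀ (z : ℂ) (x : Fin n → ℂ) (w : Fin m → ℂ), ‖z‖ = 1 →
      M.map Complex.ofReal *ᵥ x + G.map Complex.ofReal *ᵥ w = z • x →
      (star x ⬝ᵥ S.map Complex.ofReal *ᵥ x).re ≤ j ^ 2 * (star w ⬝ᵥ w).re) :
    ∃ P, IsStorageMatrix M G S j P := by
  have hS' : Sᵀ = S := by simpa using hS.isHermitian.eq
  let t : ℕ → Set (Matrix (Fin n) (Fin n) ℝ) := fun k =>
    {P | IsStorageMatrix M G S (j + 1 / ((k : ℝ) + 1)) P}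
  have hcl : ∀ k, IsClosed (t k) := fun k => isClosed_setOf_isStorageMatrix hS'
  have hmono : ∀ k, t (k + 1) ⊆ t k := by
    intro k P hP
    refine (isStorageMatrix_iff hS').2 ⟨hP.1, fun x w => ?_⟩
    have h1 := ((isStorageMatrix_iff hS').1 hP).2 x w
    refine h1.trans ?_
    have hw : 0 ≤ w ⬝ᵥ w := Finset.sum_nonneg fun i _ => mul_self_nonneg (w i)
    have : 1 / (((k + 1 : ℕ) : ℝ) + 1) ≤ 1 / ((k : ℝ) + 1) := by
      push_cast
      gcongr
      linarith
    gcongr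
  have hne : ∀ k, (t k).Nonempty := fun k =>
    hM.exists_isStorageMatrix_of_lt hS' hj (lt_add_of_pos_right j (by positivity)) hfreq
  have hcomp : IsCompact (t 0) := by
    let c : Fin n → Fin n → ℝ := fun a b =>
      (j + 1 / (((0 : ℕ) : ℝ) + 1)) ^ 2 * ((N.col a ⬝ᵥ N.col a) + (N.col b ⬝ᵥ N.col b))
    have hbox : IsCompact (Set.univ.pi fun a => Set.univ.pi fun b => Set.Icc (-c a b) (c a b)) :=
      isCompact_univ_pi fun a => isCompact_univ_pi fun b => isCompact_Icc
    refine hbox.of_isClosed_subset (hcl 0) fun P hP => ?_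
    exact fun a _ b _ => abs_le.1 (IsStorageMatrix.abs_apply_le hM hS hN hP a b)
  obtain ⟨P, hP⟩ := IsCompact.nonempty_iInter_of_sequence_nonempty_isCompact_isClosed t hmono hne
    hcomp hcl
  rw [Set.mem_iInter] at hP
  refine ⟨P, (isStorageMatrix_iff hS').2 ⟨(hP 0).1, fun x w => ?_⟩⟩
  have hlim : Filter.Tendsto
      (fun k : ℕ => x ⬝ᵥ P *ᵥ x + (j + 1 / ((k : ℝ) + 1)) ^ 2 * (w ⬝ᵥ w)) Filter.atTop
      (𝓝 (x ⬝ᵥ P *ᵥ x + (j + 0) ^ 2 * (w ⬝ᵥ w))) :=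
    (((tendsto_one_div_add_atTop_nhds_zero_nat.const_add j).pow 2).mul_const _).const_add _
  rw [add_zero] at hlim
  exact ge_of_tendsto hlim
    (Filter.Eventually.of_forall fun k => ((isStorageMatrix_iff hS').1 (hP k)).2 x w)

end BoundedReal

end

/-! ### The descent inequality and Clarke directional derivatives -/

section

open Matrix

open scoped ComplexOrder

theorem star_dotProduct_re_comm {n : Type*} [Fintype n] (a b : n → ℂ) :
    (star a ⬝ᵥ b).re = (star b ⬝ᵥ a).re := by
  rw [← Complex.conj_re, ← Complex.star_def, star_dotProduct, star_star]

theorem Matrix.PosSemidef.two_mul_re_dotProduct_mulVec_le {n : Type*} [Fintype n]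
    {P : Matrix n n ℂ} (hP : P.PosSemidef) (a b : n → ℂ) :
    2 * (star a ⬝ᵥ P *ᵥ b).re ≤ (star a ⬝ᵥ P *ᵥ a).re + (star b ⬝ᵥ P *ᵥ b).re := by
  have h1 : 0 ≤ (star (a - b) ⬝ᵥ P *ᵥ (a - b)).re := by
    simpa using (Complex.le_def.1 (hP.dotProduct_mulVec_nonneg (a - b))).1
  have h2 : (star b ⬝ᵥ P *ᵥ a).re = (star a ⬝ᵥ P *ᵥ b).re := by
    rw [star_dotProduct_re_comm, star_mulVec_dotProduct, hP.isHermitian.eq]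
  simp only [star_sub, mulVec_sub, sub_dotProduct, dotProduct_sub, Complex.sub_re] at h1
  linarith

/-- Descent inequality behind hidden convexity. Let `x` be the state at a worst-case frequency `z`
and input `v` for the gain `K`, where the dissipation inequality with storage `P` is tight, so that
`P (z x)` is the adjoint state. In the direction `V = (K₀ - K) P₀⁻¹ P`, with `P₀` a storage matrix
for the gain `K₀`, one has `V x = (K₀ - K) y` where `P₀ y = P x`, and the left-hand side is the
derivative along `V` of the output energy at `(z, v)`. It is negative when
`γ₀² < γ²`. -/
theorem descent_inequality {n k m : Type*} [Fintype n] [Fintype k] [Fintype m]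
    {A Q P P₀ : Matrix n n ℂ} {B : Matrix n k ℂ} {G : Matrix n m ℂ} {R : Matrix k k ℂ}
    {K K₀ : Matrix k n ℂ} (hQ : Q.PosSemidef) (hR : R.PosSemidef) (hP₀ : P₀.PosSemidef)
    {γ γ₀ : ℝ} {z : ℂ} (hz : ‖z‖ = 1) {x y : n → ℂ} {v : m → ℂ}
    (hadj : (A + B * K)ᴴ *ᵥ P *ᵥ (z • x) = P *ᵥ x - (Q + Kᴴ * R * K) *ᵥ x)
    (hin : Gᴴ *ᵥ P *ᵥ (z • x) = ((γ ^ 2 : ℝ) : ℂ) • v)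
    (hy : P₀ *ᵥ y = P *ᵥ x)
    (hdis : (star ((A + B * K₀) *ᵥ y + G *ᵥ v) ⬝ᵥ P₀ *ᵥ ((A + B * K₀) *ᵥ y + G *ᵥ v)).re +
      (star y ⬝ᵥ (Q + K₀ᴴ * R * K₀) *ᵥ y).re ≤
        (star y ⬝ᵥ P₀ *ᵥ y).re + γ₀ ^ 2 * (star v ⬝ᵥ v).re)
    (hv : (star v ⬝ᵥ v).re = 1) (hmax : (star x ⬝ᵥ (Q + Kᴴ * R * K) *ᵥ x).re = γ ^ 2) :
    2 * ((star (R *ᵥ K *ᵥ x) ⬝ᵥ (K₀ - K) *ᵥ y).re +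
      (star (P *ᵥ (z • x)) ⬝ᵥ B *ᵥ (K₀ - K) *ᵥ y).re) ≤ γ₀ ^ 2 - γ ^ 2 := by
  -- The successor of `y` under the gain `K₀` and the worst-case input for `K`.
  set b := (A + B * K₀) *ᵥ y + G *ᵥ v with hb
  have hPz : P *ᵥ (z • x) = P₀ *ᵥ (z • y) := by rw [mulVec_smul, mulVec_smul, hy]
  have hinput : B *ᵥ (K₀ - K) *ᵥ y = b - G *ᵥ v - (A + B * K) *ᵥ y := by
    simp only [hb, sub_mulVec, mulVec_sub, add_mulVec, mulVec_mulVec]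
    abel
  have h1 : star (P *ᵥ (z • x)) ⬝ᵥ G *ᵥ v = ((γ ^ 2 : ℝ) : ℂ) * (star v ⬝ᵥ v) := by
    rw [← conjTranspose_conjTranspose G, ← star_mulVec_dotProduct, hin, star_smul, smul_dotProduct,
      smul_eq_mul, Complex.star_def, Complex.conj_ofReal]
  have h2 : star (P *ᵥ (z • x)) ⬝ᵥ (A + B * K) *ᵥ y =
      star (P₀ *ᵥ y) ⬝ᵥ y - (star (Q *ᵥ x) ⬝ᵥ y + star (R *ᵥ K *ᵥ x) ⬝ᵥ K *ᵥ y) := by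
    rw [← conjTranspose_conjTranspose (A + B * K), ← star_mulVec_dotProduct, hadj, ← hy, star_sub,
      sub_dotProduct, add_mulVec, star_add, add_dotProduct, ← mulVec_mulVec, ← mulVec_mulVec,
      star_mulVec_dotProduct Kᴴ, conjTranspose_conjTranspose, star_mulVec_dotProduct]
  -- The remaining cross terms are bounded by Young's inequality for `P₀`, `Q` and `R`.
  have h3 : 2 * (star (P *ᵥ (z • x)) ⬝ᵥ b).re ≤
      (star y ⬝ᵥ P₀ *ᵥ y).re + (star b ⬝ᵥ P₀ *ᵥ b).re := by
    have h := hP₀.two_mul_re_dotProduct_mulVec_le (z • y) b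
    have hzz : star (z • y) ⬝ᵥ P₀ *ᵥ (z • y) = star y ⬝ᵥ P₀ *ᵥ y := by
      rw [star_smul, mulVec_smul, smul_dotProduct, dotProduct_smul, smul_smul, Complex.star_def,
        Complex.conj_mul', hz]
      simp
    rw [hzz] at h
    rwa [hPz, star_mulVec_dotProduct, hP₀.isHermitian.eq]
  have h4 : (star (P₀ *ᵥ y) ⬝ᵥ y).re = (star y ⬝ᵥ P₀ *ᵥ y).re := star_dotProduct_re_comm _ _
  have h5 : 2 * (star (Q *ᵥ x) ⬝ᵥ y).re ≤ (star x ⬝ᵥ Q *ᵥ x).re + (star y ⬝ᵥ Q *ᵥ y).re := by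
    rw [star_mulVec_dotProduct, hQ.isHermitian.eq]
    exact hQ.two_mul_re_dotProduct_mulVec_le x y
  have h6 : 2 * (star (R *ᵥ K *ᵥ x) ⬝ᵥ K₀ *ᵥ y).re ≤
      (star x ⬝ᵥ (Kᴴ * R * K) *ᵥ x).re + (star y ⬝ᵥ (K₀ᴴ * R * K₀) *ᵥ y).re := by
    rw [star_mulVec_dotProduct, hR.isHermitian.eq]
    have h := hR.two_mul_re_dotProduct_mulVec_le (K *ᵥ x) (K₀ *ᵥ y)
    rw [star_mulVec_dotProduct K, star_mulVec_dotProduct K₀] at h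
    simpa only [star_mulVec_dotProduct, mulVec_mulVec, Matrix.mul_assoc] using h
  rw [hinput, dotProduct_sub, dotProduct_sub, h1, h2, sub_mulVec, dotProduct_sub]
  simp only [Complex.sub_re, Complex.add_re, Complex.re_ofReal_mul, h4, hv]
  rw [add_mulVec, dotProduct_add, Complex.add_re] at hdis hmax
  rw [hv] at hdis
  linarith

/-- Danskin's estimate for a maximum of functions over a compact set: if the difference quotients
along `v` of the active functions are bounded away from `0` at `x`, uniformly, then the Clarke
directional derivative along `v` is negative. -/
theorem clarkeDirDeriv_lt_zero_of_isCompact {E X : Type*} [AddCommGroup E] [Module ℝ E]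
    [TopologicalSpace E] [ContinuousAdd E] [ContinuousSMul ℝ E] [TopologicalSpace X] {s : Set X}
    (hs : IsCompact s) {f : E → ℝ} {φ : E → X → ℝ} {q : E → E → X → ℝ} {x v : E} {δ : ℝ}
    (hδ : 0 < δ) (hle : ∀ᶠ y in 𝓝 x, ∀ p ∈ s, φ y p ≤ f y)
    (hmax : ∀ᶠ y in 𝓝 x, ∃ p ∈ s, φ y p = f y)
    (hq : ∀ᶠ y in 𝓝 x ×ˢ 𝓝 x, ∀ t : ℝ, y.2 = y.1 + t • v →
      ∀ p ∈ s, φ y.2 p - φ y.1 p = t * q y.1 y.2 p)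
    (hφc : ∀ p ∈ s, ContinuousAt (fun y : E × X => φ y.1 y.2) (x, p))
    (hqc : ∀ p ∈ s, ContinuousAt (fun y : (E × E) × X => q y.1.1 y.1.2 y.2) ((x, x), p))
    (hneg : ∀ p ∈ s, φ x p = f x → q x x p ≤ -δ) :
    clarkeDirDeriv f x v < 0 := by
  have hle' : ∀ p ∈ s, φ x p ≤ f x := hle.self_of_nhds
  obtain ⟨p₀, hp₀, hp₀'⟩ := hmax.self_of_nhds
  have hsnd : Filter.Tendsto Prod.snd (𝓝 (x, x)) (𝓝 x) := continuous_snd.tendsto (x, x)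
  have hfst : Filter.Tendsto Prod.fst (𝓝 (x, x)) (𝓝 x) := continuous_fst.tendsto (x, x)
  -- Near `x` a maximizer has difference quotient at most `-δ / 2`.
  have hkey : ∀ᶠ y in 𝓝 (x, x), ∀ p ∈ s, φ y.2 p < f y.2 ∨ q y.1 y.2 p ≤ -(δ / 2) := by
    refine hs.eventually_forall_of_forall_eventually
      (P := fun (y : E × E) p => φ y.2 p < f y.2 ∨ q y.1 y.2 p ≤ -(δ / 2)) fun p hp => ?_
    rcases (hle' p hp).lt_or_eq with hlt | heq
    -- An inactive `p` stays below the value of a maximizer `p₀` at `x`, hence below `f`.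
    · obtain ⟨c, hc1, hc2⟩ := exists_between hlt
      rw [← hp₀'] at hc2
      have hpair : Filter.Tendsto (fun y : (E × E) × X => (y.1.2, y.2)) (𝓝 ((x, x), p))
          (𝓝 (x, p)) := Continuous.tendsto (by fun_prop) ((x, x), p)
      have hpair₀ : Filter.Tendsto (fun y : (E × E) × X => (y.1.2, p₀)) (𝓝 ((x, x), p))
          (𝓝 (x, p₀)) := Continuous.tendsto
            (f := fun y : (E × E) × X => (y.1.2, p₀)) (by fun_prop) ((x, x), p)
      have hcomp : Filter.Tendsto (fun y : (E × E) × X => y.1.2) (𝓝 ((x, x), p)) (𝓝 x) :=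
        Continuous.tendsto (f := fun y : (E × E) × X => y.1.2) (by fun_prop) ((x, x), p)
      filter_upwards [hpair.eventually ((hφc p hp).eventually_lt_const hc1),
        hpair₀.eventually ((hφc p₀ hp₀).eventually_const_lt hc2), hcomp.eventually hle]
        with y h1 h2 h3
      exact Or.inl (h1.trans (h2.trans_le (h3 p₀ hp₀)))
    · have h1 : q x x p < -(δ / 2) := by linarith [hneg p hp heq]
      filter_upwards [(hqc p hp).eventually_lt_const h1] with y hy
      exact Or.inr hy.le
  have htend : Filter.Tendsto (fun y : E × ℝ => (y.1, y.1 + y.2 • v)) (𝓝 x ×ˢ 𝓝[>] (0 : ℝ))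
      (𝓝 (x, x)) := by
    have hc : Continuous fun y : E × ℝ => (y.1, y.1 + y.2 • v) := by fun_prop
    have h1 := hc.tendsto (x, 0)
    simp only [zero_smul, add_zero] at h1
    refine h1.mono_left ?_
    rw [nhds_prod_eq]
    exact Filter.prod_mono le_rfl nhdsWithin_le_nhds
  have hpos : ∀ᶠ y : E × ℝ in 𝓝 x ×ˢ 𝓝[>] (0 : ℝ), 0 < y.2 :=
    Filter.tendsto_snd.eventually (eventually_mem_nhdsWithin (a := (0 : ℝ)) (s := Set.Ioi 0))
  rw [← nhds_prod_eq] at hq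
  have hbound : clarkeDirDeriv f x v ≤ ((-(δ / 2) : ℝ) : EReal) := by
    refine Filter.limsup_le_of_le (by isBoundedDefault) ?_
    filter_upwards [hpos, htend.eventually hkey, htend.eventually hq,
      htend.eventually (hfst.eventually hle), htend.eventually (hsnd.eventually hmax)]
      with y hy hk hq hle hmax
    obtain ⟨p, hp, hpe⟩ := hmax
    have h1 := (hk p hp).resolve_left hpe.not_lt
    have h2 := hq y.2 rfl p hp
    have h3 := hle p hp
    refine EReal.coe_le_coe_iff.2 ((div_le_iff₀ hy).2 ?_)
    nlinarith
  exact hbound.trans_lt (by exact_mod_cast (by linarith : -(δ / 2) < 0))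

/-- At a local minimizer the Clarke directional derivatives are nonnegative. -/
theorem IsLocalMin.clarkeDirDeriv_nonneg {E : Type*} [AddCommGroup E] [Module ℝ E]
    [TopologicalSpace E] [ContinuousAdd E] [ContinuousSMul ℝ E] {f : E → ℝ} {x : E}
    (hf : IsLocalMin f x) (v : E) : 0 ≤ clarkeDirDeriv f x v := by
  refine Filter.le_limsup_of_frequently_le ?_ (by isBoundedDefault)
  have hc : Continuous fun t : ℝ => x + t • v := by fun_prop
  have h1 : Filter.Tendsto (fun t : ℝ => x + t • v) (𝓝[>] 0) (𝓝 x) := by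
    simpa using (hc.tendsto 0).mono_left nhdsWithin_le_nhds
  have h2 : ∀ᶠ t in 𝓝[>] (0 : ℝ), (0 : EReal) ≤ (((f (x + t • v) - f x) / t : ℝ) : EReal) := by
    filter_upwards [h1.eventually hf, self_mem_nhdsWithin] with t ht ht0
    have ht0 : 0 < t := ht0
    exact_mod_cast div_nonneg (sub_nonneg.2 ht) ht0.le
  have h3 : Filter.Tendsto (fun t : ℝ => (x, t)) (𝓝[>] 0) (𝓝 x ×ˢ 𝓝[>] 0) :=
    tendsto_const_nhds.prodMk Filter.tendsto_id
  exact h3.frequently h2.frequently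

end

/-! ### Singular vectors and the unit circle -/

section

open Matrix

open scoped ComplexOrder

section SigmaMax

variable {m n : Type*} [Fintype m] [Fintype n]

theorem EuclideanSpace.norm_sq_eq_re_dotProduct (v : EuclideanSpace ℂ n) :
    ‖v‖ ^ 2 = (star v.ofLp ⬝ᵥ v.ofLp).re := by
  rw [← inner_self_eq_norm_sq (𝕜 := ℂ), EuclideanSpace.inner_eq_star_dotProduct, dotProduct_comm]
  rfl

theorem re_dotProduct_eq_inner [DecidableEq n] (M : Matrix m n ℂ) (u : EuclideanSpace ℂ m)
    (v : EuclideanSpace ℂ n) :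
    (star u.ofLp ⬝ᵥ M *ᵥ v.ofLp).re =
      (inner ℂ u (LinearMap.toContinuousLinearMap (Matrix.toEuclideanLin M) v)).re := by
  rw [EuclideanSpace.inner_eq_star_dotProduct, dotProduct_comm]
  rfl

variable [DecidableEq m] [DecidableEq n]

theorem sigmaMax_nonneg (M : Matrix m n ℂ) : 0 ≤ sigmaMax M := by
  rw [sigmaMax_eq_norm]
  exact norm_nonneg _

theorem re_dotProduct_mulVec_le_sigmaMax (M : Matrix m n ℂ) (v : n → ℂ) :
    (star (M *ᵥ v) ⬝ᵥ M *ᵥ v).re ≤ sigmaMax M ^ 2 * (star v ⬝ᵥ v).re := by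
  have h := (LinearMap.toContinuousLinearMap (Matrix.toEuclideanLin M)).le_opNorm (WithLp.toLp 2 v)
  rw [← sigmaMax_eq_norm] at h
  have h2 := pow_le_pow_left₀ (norm_nonneg _) h 2
  rw [mul_pow, EuclideanSpace.norm_sq_eq_re_dotProduct, EuclideanSpace.norm_sq_eq_re_dotProduct]
    at h2
  exact h2

theorem re_dotProduct_le_sigmaMax (M : Matrix m n ℂ) {u : EuclideanSpace ℂ m}
    {v : EuclideanSpace ℂ n} (hu : ‖u‖ ≤ 1) (hv : ‖v‖ ≤ 1) :
    (star u.ofLp ⬝ᵥ M *ᵥ v.ofLp).re ≤ sigmaMax M := by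
  rw [re_dotProduct_eq_inner, sigmaMax_eq_norm]
  set T := LinearMap.toContinuousLinearMap (Matrix.toEuclideanLin M)
  calc (inner ℂ u (T v)).re ≤ ‖u‖ * ‖T v‖ := re_inner_le_norm (𝕜 := ℂ) u (T v)
    _ ≤ 1 * (‖T‖ * 1) := by
      gcongr
      exact (T.le_opNorm v).trans (by gcongr)
    _ = ‖T‖ := by ring

theorem exists_re_dotProduct_eq_sigmaMax (M : Matrix m n ℂ) :
    ∃ u : EuclideanSpace ℂ m, ‖u‖ ≤ 1 ∧ ∃ v : EuclideanSpace ℂ n, ‖v‖ ≤ 1 ∧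
      (star u.ofLp ⬝ᵥ M *ᵥ v.ofLp).re = sigmaMax M := by
  simp only [re_dotProduct_eq_inner, sigmaMax_eq_norm]
  set T := LinearMap.toContinuousLinearMap (Matrix.toEuclideanLin M)
  obtain ⟨v, hv, hmax⟩ := (isCompact_closedBall (0 : EuclideanSpace ℂ n) 1).exists_sSup_image_eq
    ⟨0, by simp⟩ T.continuous.norm.continuousOn
  rw [T.sSup_unitClosedBall_eq_norm] at hmax
  refine ⟨((‖T v‖⁻¹ : ℝ) : ℂ) • T v, ?_, v, by simpa using hv, ?_⟩
  · rw [norm_smul, Complex.norm_real, norm_inv, norm_norm]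
    exact inv_mul_le_one
  · rw [inner_smul_left, inner_self_eq_norm_sq_to_K, hmax, Complex.conj_ofReal,
      Complex.re_ofReal_mul]
    rcases eq_or_ne ‖T v‖ 0 with h0 | h0
    · simp [h0]
    · norm_cast
      change ‖T v‖⁻¹ * ‖T v‖ ^ 2 = ‖T v‖
      field_simp

/-- Equality case: maximizing pairs for a positive `sigmaMax` consist of singular vectors. -/
theorem singularVectors_of_re_dotProduct_eq_sigmaMax {M : Matrix m n ℂ} (hM : 0 < sigmaMax M)
    {u : EuclideanSpace ℂ m} {v : EuclideanSpace ℂ n} (hu : ‖u‖ ≤ 1) (hv : ‖v‖ ≤ 1)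
    (h : (star u.ofLp ⬝ᵥ M *ᵥ v.ofLp).re = sigmaMax M) :
    M *ᵥ v.ofLp = (sigmaMax M : ℂ) • u.ofLp ∧ ‖u‖ = 1 ∧ ‖v‖ = 1 := by
  rw [re_dotProduct_eq_inner] at h
  set T := LinearMap.toContinuousLinearMap (Matrix.toEuclideanLin M) with hT
  have hσ : sigmaMax M = ‖T‖ := sigmaMax_eq_norm M
  rw [hσ] at h hM
  have h1 : (inner ℂ u (T v)).re ≤ ‖u‖ * ‖T v‖ := re_inner_le_norm (𝕜 := ℂ) u (T v)
  have h2 := T.le_opNorm v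
  have hv1 : ‖v‖ = 1 := by
    refine le_antisymm hv (le_of_mul_le_mul_left ?_ hM)
    nlinarith [norm_nonneg (T v)]
  have hTv : ‖T v‖ = ‖T‖ := by
    rw [hv1, mul_one] at h2
    refine le_antisymm h2 ?_
    nlinarith [norm_nonneg (T v)]
  have hu1 : ‖u‖ = 1 := by
    rw [hTv] at h1
    refine le_antisymm hu (le_of_mul_le_mul_right ?_ hM)
    linarith
  refine ⟨?_, hu1, hv1⟩
  have h3 : T v = (‖T‖ : ℂ) • u := by
    rw [← sub_eq_zero, ← norm_eq_zero, ← sq_eq_zero_iff, @norm_sub_sq ℂ, hTv, norm_smul,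
      inner_smul_right, RCLike.re_eq_complex_re, Complex.re_ofReal_mul, ← Complex.conj_re,
      inner_conj_symm, h, hu1]
    simp
    ring
  have h4 := congrArg WithLp.ofLp h3
  rw [hσ]
  exact h4

end SigmaMax

theorem continuousAt_re_dotProduct_mulVec {m n Y : Type*} [Fintype m] [Fintype n]
    [TopologicalSpace Y] {T : Y → Matrix m n ℂ} {u : Y → m → ℂ} {v : Y → n → ℂ} {y₀ : Y}
    (hT : ContinuousAt T y₀) (hu : ContinuousAt u y₀) (hv : ContinuousAt v y₀) :
    ContinuousAt (fun y => (star (u y) ⬝ᵥ T y *ᵥ v y).re) y₀ := by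
  have hF : Continuous fun a : Matrix m n ℂ × (m → ℂ) × (n → ℂ) =>
      (star a.2.1 ⬝ᵥ a.1 *ᵥ a.2.2).re := Complex.continuous_re.comp (by fun_prop)
  exact ContinuousAt.comp (f := fun y => (T y, u y, v y)) hF.continuousAt
    (hT.prodMk (hu.prodMk hv))

theorem Matrix.exists_right_inverse_of_rank_eq {n m : ℕ} {G : Matrix (Fin n) (Fin m) ℝ}
    (hG : G.rank = n) : ∃ N : Matrix (Fin m) (Fin n) ℝ, G * N = 1 := by
  rw [← mulVec_surjective_iff_exists_right_inverse]
  have h1 : LinearMap.range G.mulVecLin = ⊤ :=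
    Submodule.eq_top_of_finrank_eq (by rw [← Matrix.rank, hG]; simp)
  exact LinearMap.range_eq_top.1 h1

theorem Complex.exists_mem_Icc_exp_I_mul_eq {z : ℂ} (hz : ‖z‖ = 1) :
    ∃ ω ∈ Set.Icc (0 : ℝ) (2 * Real.pi), Complex.exp (Complex.I * ω) = z := by
  have h1 : Complex.exp (Complex.I * z.arg) = z := by
    have := Complex.norm_mul_exp_arg_mul_I z
    rwa [hz, Complex.ofReal_one, one_mul, mul_comm] at this
  have hpi := Real.pi_pos
  rcases le_total 0 z.arg with h | h
  · exact ⟨z.arg, ⟨h, by linarith [Complex.arg_le_pi z]⟩, h1⟩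
  · refine ⟨z.arg + 2 * Real.pi, ⟨by linarith [Complex.neg_pi_lt_arg z], by linarith⟩, ?_⟩
    rw [← h1]
    push_cast
    rw [mul_add, Complex.exp_add, mul_comm Complex.I (2 * (Real.pi : ℂ)), Complex.exp_two_pi_mul_I,
      mul_one]
    simp [h1]

end

/-! ### The closed loop under state feedback -/

section

open Matrix

open scoped ComplexOrder

/-- The resolvent `(e^{jω} I - (A + B K))⁻¹` of the closed loop under state feedback. -/
noncomputable def closedLoopResolvent {nx nu : ℕ} (A : Matrix (Fin nx) (Fin nx) ℝ)
    (B : Matrix (Fin nx) (Fin nu) ℝ) (K : Matrix (Fin nu) (Fin nx) ℝ) (ω : ℝ) :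
    Matrix (Fin nx) (Fin nx) ℂ :=
  (Complex.exp (Complex.I * ω) • (1 : Matrix (Fin nx) (Fin nx) ℂ) -
    (A + B * K).map Complex.ofReal)⁻¹

/-- The performance output matrix `[Q^{1/2}; R^{1/2} K]` under state feedback. -/
noncomputable def performanceOutput {nx nu : ℕ} (Q : Matrix (Fin nx) (Fin nx) ℝ)
    (R : Matrix (Fin nu) (Fin nu) ℝ) (K : Matrix (Fin nu) (Fin nx) ℝ) :
    Matrix (Fin nx ⊕ Fin nu) (Fin nx) ℂ :=
  (fromRows (CFC.sqrt Q) (CFC.sqrt R * K)).map Complex.ofReal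

/-- The divided difference `(T (K') - T (K)) / t`, `K' = K + t V`, of the closed-loop transfer
matrix, written without `t` by means of the resolvent identity; it is jointly continuous in `K` and
`K'`. -/
noncomputable def transferSlope {nx nu nw : ℕ} (A : Matrix (Fin nx) (Fin nx) ℝ)
    (B : Matrix (Fin nx) (Fin nu) ℝ) (Bw : Matrix (Fin nx) (Fin nw) ℝ)
    (Q : Matrix (Fin nx) (Fin nx) ℝ) (R : Matrix (Fin nu) (Fin nu) ℝ)
    (V K K' : Matrix (Fin nu) (Fin nx) ℝ) (ω : ℝ) : Matrix (Fin nx ⊕ Fin nu) (Fin nw) ℂ :=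
  (performanceOutput 0 R V + performanceOutput Q R K * closedLoopResolvent A B K ω *
      (B * V).map Complex.ofReal) * closedLoopResolvent A B K' ω * Bw.map Complex.ofReal

variable {nx nu nw : ℕ} {A : Matrix (Fin nx) (Fin nx) ℝ} {B : Matrix (Fin nx) (Fin nu) ℝ}
  {Bw : Matrix (Fin nx) (Fin nw) ℝ} {Q : Matrix (Fin nx) (Fin nx) ℝ}
  {R : Matrix (Fin nu) (Fin nu) ℝ}

theorem closedLoopTransfer_one (K : Matrix (Fin nu) (Fin nx) ℝ) (ω : ℝ) :
    closedLoopTransfer A B Bw 1 Q R K ω =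
      performanceOutput Q R K * closedLoopResolvent A B K ω * Bw.map Complex.ofReal := by
  simp [closedLoopTransfer, performanceOutput, closedLoopResolvent]

theorem mem_stabilizingSet_one {K : Matrix (Fin nu) (Fin nx) ℝ} :
    K ∈ stabilizingSet A B 1 ↔ IsSchurStable (A + B * K) := by
  simp [stabilizingSet]

theorem norm_exp_I_mul_ofReal (ω : ℝ) : ‖Complex.exp (Complex.I * ω)‖ = 1 := by
  rw [mul_comm, Complex.norm_exp_ofReal_mul_I]

theorem performanceOutput_zero (K : Matrix (Fin nu) (Fin nx) ℝ) :
    performanceOutput 0 R K = (fromRows 0 (CFC.sqrt R * K)).map Complex.ofReal := by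
  rw [performanceOutput, CFC.sqrt_zero]

theorem conjTranspose_performanceOutput_mul_self (hQ : Q.PosSemidef) (hR : R.PosSemidef)
    (K : Matrix (Fin nu) (Fin nx) ℝ) :
    (performanceOutput Q R K)ᴴ * performanceOutput Q R K =
      (Q + Kᵀ * R * K).map Complex.ofReal := by
  rw [performanceOutput, conjTranspose_map_ofReal, ← map_ofReal_mul, transpose_fromRows,
    fromCols_mul_fromRows, hQ.transpose_sqrt_mul_sqrt, transpose_mul, Matrix.mul_assoc Kᵀ,
    ← Matrix.mul_assoc _ _ K, hR.transpose_sqrt_mul_sqrt, Matrix.mul_assoc]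

theorem conjTranspose_performanceOutput_mul_zero (hR : R.PosSemidef)
    (K V : Matrix (Fin nu) (Fin nx) ℝ) :
    (performanceOutput Q R K)ᴴ * performanceOutput 0 R V =
      (Kᵀ * R * V).map Complex.ofReal := by
  rw [performanceOutput_zero, performanceOutput, conjTranspose_map_ofReal, ← map_ofReal_mul,
    transpose_fromRows, fromCols_mul_fromRows, transpose_mul, Matrix.mul_assoc Kᵀ,
    ← Matrix.mul_assoc _ _ V, hR.transpose_sqrt_mul_sqrt, Matrix.mul_assoc, Matrix.mul_zero,
    zero_add]

section Resolvent

variable {K : Matrix (Fin nu) (Fin nx) ℝ}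

theorem isUnit_det_closedLoop (hK : K ∈ stabilizingSet A B 1) (ω : ℝ) :
    IsUnit (Complex.exp (Complex.I * ω) • (1 : Matrix (Fin nx) (Fin nx) ℂ) -
      (A + B * K).map Complex.ofReal).det :=
  (det_smul_one_sub_ne_zero (mem_stabilizingSet_one.1 hK) (norm_exp_I_mul_ofReal ω)).isUnit

theorem mul_closedLoopResolvent (hK : K ∈ stabilizingSet A B 1) (ω : ℝ) :
    (Complex.exp (Complex.I * ω) • (1 : Matrix (Fin nx) (Fin nx) ℂ) -
      (A + B * K).map Complex.ofReal) * closedLoopResolvent A B K ω = 1 :=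
  mul_nonsing_inv _ (isUnit_det_closedLoop hK ω)

theorem closedLoopResolvent_mul (hK : K ∈ stabilizingSet A B 1) (ω : ℝ) :
    closedLoopResolvent A B K ω * (Complex.exp (Complex.I * ω) • (1 : Matrix (Fin nx) (Fin nx) ℂ) -
      (A + B * K).map Complex.ofReal) = 1 :=
  nonsing_inv_mul _ (isUnit_det_closedLoop hK ω)

theorem continuousAt_closedLoopResolvent (hK : K ∈ stabilizingSet A B 1) (ω : ℝ) :
    ContinuousAt (fun p : Matrix (Fin nu) (Fin nx) ℝ × ℝ => closedLoopResolvent A B p.1 p.2)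
      (K, ω) := by
  have hc : Continuous fun p : Matrix (Fin nu) (Fin nx) ℝ × ℝ =>
      Complex.exp (Complex.I * p.2) • (1 : Matrix (Fin nx) (Fin nx) ℂ) -
        (A + B * p.1).map Complex.ofReal := by
    have h1 : Continuous fun p : Matrix (Fin nu) (Fin nx) ℝ × ℝ => A + B * p.1 := by fun_prop
    have h2 : Continuous fun p : Matrix (Fin nu) (Fin nx) ℝ × ℝ =>
        (A + B * p.1).map Complex.ofReal := h1.matrix_map Complex.continuous_ofReal
    have h3 : Continuous fun p : Matrix (Fin nu) (Fin nx) ℝ × ℝ =>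
        Complex.exp (Complex.I * p.2) • (1 : Matrix (Fin nx) (Fin nx) ℂ) := by fun_prop
    exact h3.sub h2
  set D := fun p : Matrix (Fin nu) (Fin nx) ℝ × ℝ =>
    Complex.exp (Complex.I * p.2) • (1 : Matrix (Fin nx) (Fin nx) ℂ) -
      (A + B * p.1).map Complex.ofReal with hD
  have hdet : (D (K, ω)).det ≠ 0 := (isUnit_det_closedLoop hK ω).ne_zero
  have hinv : (fun p : Matrix (Fin nu) (Fin nx) ℝ × ℝ => closedLoopResolvent A B p.1 p.2) =
      fun p => (D p).det⁻¹ • (D p).adjugate := by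
    funext p
    rw [closedLoopResolvent, Matrix.inv_def, Ring.inverse_eq_inv']
  rw [hinv]
  have hdetc : ContinuousAt (fun p => (D p).det) (K, ω) := hc.matrix_det.continuousAt
  have hadjc : ContinuousAt (fun p => (D p).adjugate) (K, ω) := hc.matrix_adjugate.continuousAt
  exact (hdetc.inv₀ hdet).smul hadjc

end Resolvent

theorem continuous_performanceOutput :
    Continuous fun K : Matrix (Fin nu) (Fin nx) ℝ => performanceOutput Q R K := by
  refine Continuous.matrix_map ?_ Complex.continuous_ofReal
  refine continuous_matrix fun i j => ?_
  rcases i with i | i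
  · exact continuous_const
  · have : Continuous fun K : Matrix (Fin nu) (Fin nx) ℝ => CFC.sqrt R * K := by fun_prop
    exact this.matrix_elem i j

theorem continuousAt_closedLoopTransfer {K : Matrix (Fin nu) (Fin nx) ℝ}
    (hK : K ∈ stabilizingSet A B 1) (ω : ℝ) :
    ContinuousAt (fun p : Matrix (Fin nu) (Fin nx) ℝ × ℝ =>
      closedLoopTransfer A B Bw 1 Q R p.1 p.2) (K, ω) := by
  simp only [closedLoopTransfer_one]
  have hC := (continuous_performanceOutput (Q := Q) (R := R)).comp
    (continuous_fst (X := Matrix (Fin nu) (Fin nx) ℝ) (Y := ℝ))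
  have hF : Continuous fun a : Matrix (Fin nx ⊕ Fin nu) (Fin nx) ℂ × Matrix (Fin nx) (Fin nx) ℂ =>
      a.1 * a.2 * Bw.map Complex.ofReal := by fun_prop
  exact ContinuousAt.comp (f := fun p : Matrix (Fin nu) (Fin nx) ℝ × ℝ =>
    (performanceOutput Q R p.1, closedLoopResolvent A B p.1 p.2)) hF.continuousAt
    (hC.continuousAt.prodMk (continuousAt_closedLoopResolvent hK ω))

theorem continuousAt_transferSlope {K : Matrix (Fin nu) (Fin nx) ℝ}
    (hK : K ∈ stabilizingSet A B 1) (V : Matrix (Fin nu) (Fin nx) ℝ) (ω : ℝ) :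
    ContinuousAt (fun p : (Matrix (Fin nu) (Fin nx) ℝ × Matrix (Fin nu) (Fin nx) ℝ) × ℝ =>
      transferSlope A B Bw Q R V p.1.1 p.1.2 p.2) ((K, K), ω) := by
  have hC := (continuous_performanceOutput (Q := Q) (R := R)).comp
    (f := fun p : (Matrix (Fin nu) (Fin nx) ℝ × Matrix (Fin nu) (Fin nx) ℝ) × ℝ => p.1.1)
    (by fun_prop)
  have hS : ContinuousAt (fun p : (Matrix (Fin nu) (Fin nx) ℝ × Matrix (Fin nu) (Fin nx) ℝ) × ℝ =>
      closedLoopResolvent A B p.1.1 p.2) ((K, K), ω) :=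
    ContinuousAt.comp (g := fun p : Matrix (Fin nu) (Fin nx) ℝ × ℝ =>
        closedLoopResolvent A B p.1 p.2)
      (f := fun p : (Matrix (Fin nu) (Fin nx) ℝ × Matrix (Fin nu) (Fin nx) ℝ) × ℝ => (p.1.1, p.2))
      (continuousAt_closedLoopResolvent hK ω) (Continuous.continuousAt (by fun_prop))
  have hS' : ContinuousAt (fun p : (Matrix (Fin nu) (Fin nx) ℝ × Matrix (Fin nu) (Fin nx) ℝ) × ℝ =>
      closedLoopResolvent A B p.1.2 p.2) ((K, K), ω) :=
    ContinuousAt.comp (g := fun p : Matrix (Fin nu) (Fin nx) ℝ × ℝ =>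
        closedLoopResolvent A B p.1 p.2)
      (f := fun p : (Matrix (Fin nu) (Fin nx) ℝ × Matrix (Fin nu) (Fin nx) ℝ) × ℝ => (p.1.2, p.2))
      (continuousAt_closedLoopResolvent hK ω) (Continuous.continuousAt (by fun_prop))
  have hF : Continuous fun a : Matrix (Fin nx ⊕ Fin nu) (Fin nx) ℂ ×
      Matrix (Fin nx) (Fin nx) ℂ × Matrix (Fin nx) (Fin nx) ℂ =>
      (performanceOutput 0 R V + a.1 * a.2.1 * (B * V).map Complex.ofReal) * a.2.2 *
        Bw.map Complex.ofReal := by fun_prop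
  exact ContinuousAt.comp
    (f := fun p : (Matrix (Fin nu) (Fin nx) ℝ × Matrix (Fin nu) (Fin nx) ℝ) × ℝ =>
      (performanceOutput Q R p.1.1, closedLoopResolvent A B p.1.1 p.2,
        closedLoopResolvent A B p.1.2 p.2)) hF.continuousAt
    (hC.continuousAt.prodMk (hS.prodMk hS'))

theorem closedLoopTransfer_sub {K K' V : Matrix (Fin nu) (Fin nx) ℝ}
    (hK : K ∈ stabilizingSet A B 1) (hK' : K' ∈ stabilizingSet A B 1) {t : ℝ}
    (h : K' = K + t • V) (ω : ℝ) :
    closedLoopTransfer A B Bw 1 Q R K' ω - closedLoopTransfer A B Bw 1 Q R K ω =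
      (t : ℂ) • transferSlope A B Bw Q R V K K' ω := by
  have hC : performanceOutput Q R K' =
      performanceOutput Q R K + (t : ℂ) • performanceOutput 0 R V := by
    rw [performanceOutput_zero, performanceOutput, performanceOutput, h]
    ext i j
    rcases i with i | i <;> simp [Matrix.mul_add]
  -- The resolvent identity.
  have hS : closedLoopResolvent A B K' ω - closedLoopResolvent A B K ω =
      (t : ℂ) • (closedLoopResolvent A B K ω * (B * V).map Complex.ofReal *
        closedLoopResolvent A B K' ω) := by
    have hBV : (Complex.exp (Complex.I * ω) • (1 : Matrix (Fin nx) (Fin nx) ℂ) -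
        (A + B * K).map Complex.ofReal) - (Complex.exp (Complex.I * ω) •
          (1 : Matrix (Fin nx) (Fin nx) ℂ) - (A + B * K').map Complex.ofReal) =
        (t : ℂ) • (B * V).map Complex.ofReal := by
      rw [h]
      ext i j
      simp [Matrix.mul_add]
    rw [← Matrix.smul_mul, ← Matrix.mul_smul, ← hBV, Matrix.mul_sub, Matrix.sub_mul,
      closedLoopResolvent_mul hK, Matrix.mul_assoc, mul_closedLoopResolvent hK', Matrix.one_mul,
      Matrix.mul_one]
  have hS' := sub_eq_iff_eq_add.1 hS
  rw [closedLoopTransfer_one, closedLoopTransfer_one, transferSlope, ← Matrix.sub_mul,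
    ← Matrix.smul_mul]
  congr 1
  rw [hC, Matrix.add_mul]
  nth_rw 1 [hS']
  simp only [Matrix.add_mul, Matrix.mul_add, Matrix.smul_mul, Matrix.mul_smul, smul_add,
    Matrix.mul_assoc]
  abel

section Cost

variable {K : Matrix (Fin nu) (Fin nx) ℝ}

theorem hInfCost_nonneg (hK : K ∈ stabilizingSet A B 1) : 0 ≤ hInfCost A B Bw 1 Q R K := by
  obtain ⟨ω, -, h, -⟩ := exists_hInfCost_eq A B Bw 1 Q R K hK
  rw [h]
  exact sigmaMax_nonneg _

theorem re_output_energy (hQ : Q.PosSemidef) (hR : R.PosSemidef) (x : Fin nx → ℂ) :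
    (star (performanceOutput Q R K *ᵥ x) ⬝ᵥ performanceOutput Q R K *ᵥ x).re =
      (star x ⬝ᵥ (Q + Kᵀ * R * K).map Complex.ofReal *ᵥ x).re := by
  rw [star_mulVec_dotProduct, mulVec_mulVec, conjTranspose_performanceOutput_mul_self hQ hR]

/-- The `H∞` cost bounds the gain at every frequency. -/
theorem frequency_inequality (hQ : Q.PosSemidef) (hR : R.PosSemidef)
    (hK : K ∈ stabilizingSet A B 1) (z : ℂ) (x : Fin nx → ℂ) (w : Fin nw → ℂ) (hz : ‖z‖ = 1)
    (h : (A + B * K).map Complex.ofReal *ᵥ x + Bw.map Complex.ofReal *ᵥ w = z • x) :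
    (star x ⬝ᵥ (Q + Kᵀ * R * K).map Complex.ofReal *ᵥ x).re ≤
      hInfCost A B Bw 1 Q R K ^ 2 * (star w ⬝ᵥ w).re := by
  obtain ⟨ω, hω, rfl⟩ := Complex.exists_mem_Icc_exp_I_mul_eq hz
  obtain ⟨-, -, -, hle⟩ := exists_hInfCost_eq A B Bw 1 Q R K hK
  have hx : closedLoopResolvent A B K ω *ᵥ Bw.map Complex.ofReal *ᵥ w = x := by
    rw [eq_sub_of_add_eq' h]
    have h1 : Complex.exp (Complex.I * ω) • x - (A + B * K).map Complex.ofReal *ᵥ x =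
        (Complex.exp (Complex.I * ω) • (1 : Matrix (Fin nx) (Fin nx) ℂ) -
          (A + B * K).map Complex.ofReal) *ᵥ x := by
      rw [sub_mulVec, smul_mulVec, one_mulVec]
    rw [h1, mulVec_mulVec, closedLoopResolvent_mul hK, one_mulVec]
  have h1 := re_dotProduct_mulVec_le_sigmaMax (closedLoopTransfer A B Bw 1 Q R K ω) w
  rw [closedLoopTransfer_one, ← mulVec_mulVec, ← mulVec_mulVec, hx, re_output_energy hQ hR,
    ← closedLoopTransfer_one] at h1
  refine h1.trans ?_
  have hw : 0 ≤ (star w ⬝ᵥ w).re := by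
    simpa using (Complex.le_def.1 (dotProduct_star_self_nonneg w)).1
  have h2 := hle ω hω
  have h3 := sigmaMax_nonneg (closedLoopTransfer A B Bw 1 Q R K ω)
  gcongr

theorem posDef_cost (hQ : Q.PosDef) (hR : R.PosSemidef) : (Q + Kᵀ * R * K).PosDef :=
  hQ.add_posSemidef (by simpa using hR.conjTranspose_mul_mul_same K)

end Cost

end

/-! ### Descent of the `H∞` cost -/

section

open Matrix

open scoped ComplexOrder

variable {nx nu nw : ℕ} {A : Matrix (Fin nx) (Fin nx) ℝ} {B : Matrix (Fin nx) (Fin nu) ℝ}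
  {Bw : Matrix (Fin nx) (Fin nw) ℝ} {Q : Matrix (Fin nx) (Fin nx) ℝ}
  {R : Matrix (Fin nu) (Fin nu) ℝ} {K K₀ : Matrix (Fin nu) (Fin nx) ℝ}

/-- Along `V = (K₀ - K) P₀⁻¹ P`, every active pair of singular vectors `(u, v)` at `K` gives a
derivative of the gain of at most `(γ₀² - γ²) / (2 γ)`. Since the quadratic form of the dissipation
inequality for `P` vanishes at the worst-case state and input, these lie in the kernel of its
matrix, and this identifies the adjoint state. -/
theorem re_transferSlope_le (hQ : Q.PosSemidef) (hR : R.PosSemidef)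
    (hK : K ∈ stabilizingSet A B 1) {γ γ₀ : ℝ} (hγ : 0 < γ) {P P₀ : Matrix (Fin nx) (Fin nx) ℝ}
    (hP : IsStorageMatrix (A + B * K) Bw (Q + Kᵀ * R * K) γ P)
    (hP₀ : IsStorageMatrix (A + B * K₀) Bw (Q + K₀ᵀ * R * K₀) γ₀ P₀) (hpos : P₀.PosDef) {ω : ℝ}
    {u : EuclideanSpace ℂ (Fin nx ⊕ Fin nu)} {v : EuclideanSpace ℂ (Fin nw)} (hu : ‖u‖ = 1)
    (hv : ‖v‖ = 1)
    (huv : closedLoopTransfer A B Bw 1 Q R K ω *ᵥ v.ofLp = (γ : ℂ) • u.ofLp) :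
    (star u.ofLp ⬝ᵥ
      transferSlope A B Bw Q R ((K₀ - K) * P₀⁻¹ * P) K K ω *ᵥ v.ofLp).re ≤
      -((γ ^ 2 - γ₀ ^ 2) / (2 * γ)) := by
  set z := Complex.exp (Complex.I * ω) with hz
  have hz1 : ‖z‖ = 1 := norm_exp_I_mul_ofReal ω
  set x := closedLoopResolvent A B K ω *ᵥ Bw.map Complex.ofReal *ᵥ v.ofLp with hx
  set C := performanceOutput Q R K with hC
  set y := (P₀⁻¹ * P).map Complex.ofReal *ᵥ x with hy
  have hstate : (A + B * K).map Complex.ofReal *ᵥ x + Bw.map Complex.ofReal *ᵥ v.ofLp = z • x := by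
    have h1 : (z • (1 : Matrix (Fin nx) (Fin nx) ℂ) - (A + B * K).map Complex.ofReal) *ᵥ x =
        Bw.map Complex.ofReal *ᵥ v.ofLp := by
      rw [hx, mulVec_mulVec, mul_closedLoopResolvent hK, one_mulVec]
    rw [← h1, sub_mulVec, smul_mulVec, one_mulVec]
    abel
  have hCx : C *ᵥ x = (γ : ℂ) • u.ofLp := by
    rw [← huv, closedLoopTransfer_one, ← mulVec_mulVec, ← mulVec_mulVec]
  have hu2 : (star u.ofLp ⬝ᵥ u.ofLp).re = 1 := by
    rw [← EuclideanSpace.norm_sq_eq_re_dotProduct, hu, one_pow]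
  have hv2 : (star v.ofLp ⬝ᵥ v.ofLp).re = 1 := by
    rw [← EuclideanSpace.norm_sq_eq_re_dotProduct, hv, one_pow]
  have hmax : (star x ⬝ᵥ (Q + Kᵀ * R * K).map Complex.ofReal *ᵥ x).re = γ ^ 2 := by
    rw [← re_output_energy hQ hR, ← hC, hCx, star_smul, smul_dotProduct, dotProduct_smul,
      smul_smul, Complex.star_def, Complex.conj_ofReal, smul_eq_mul, ← Complex.ofReal_mul,
      Complex.re_ofReal_mul, hu2]
    ring
  -- Tightness of the dissipation inequality at the worst case.
  have hpsd := hP.2.map_ofReal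
  rw [map_ofReal_dissipationMatrix] at hpsd
  have hzz : star (z • x) ⬝ᵥ P.map Complex.ofReal *ᵥ (z • x) =
      star x ⬝ᵥ P.map Complex.ofReal *ᵥ x := by
    rw [star_smul, mulVec_smul, smul_dotProduct, dotProduct_smul, smul_smul, Complex.star_def,
      Complex.conj_mul', hz1]
    simp
  have hker : dissipationMatrix ((A + B * K).map Complex.ofReal) (Bw.map Complex.ofReal)
      ((Q + Kᵀ * R * K).map Complex.ofReal) ((γ ^ 2 : ℝ) : ℂ) (P.map Complex.ofReal) *ᵥ
        Sum.elim x v.ofLp = 0 := by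
    rw [← hpsd.dotProduct_mulVec_zero_iff]
    have him := (Complex.le_def.1 (hpsd.dotProduct_mulVec_nonneg (Sum.elim x v.ofLp))).2
    refine Complex.ext ?_ him.symm
    rw [dotProduct_dissipationMatrix_mulVec, hstate, hzz]
    simp only [Complex.sub_re, Complex.add_re, Complex.re_ofReal_mul, hmax, hv2, Complex.zero_re]
    ring
  rw [dissipationMatrix_mulVec, hstate] at hker
  have hadj : ((A + B * K).map Complex.ofReal)ᴴ *ᵥ P.map Complex.ofReal *ᵥ (z • x) =
      P.map Complex.ofReal *ᵥ x - (Q + Kᵀ * R * K).map Complex.ofReal *ᵥ x := by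
    have h1 : P.map Complex.ofReal *ᵥ x -
        ((A + B * K).map Complex.ofReal)ᴴ *ᵥ P.map Complex.ofReal *ᵥ (z • x) -
          (Q + Kᵀ * R * K).map Complex.ofReal *ᵥ x = 0 := by
      ext i
      exact congrFun hker (Sum.inl i)
    rw [sub_right_comm, sub_eq_zero] at h1
    exact h1.symm
  have hin : (Bw.map Complex.ofReal)ᴴ *ᵥ P.map Complex.ofReal *ᵥ (z • x) =
      ((γ ^ 2 : ℝ) : ℂ) • v.ofLp := by
    have h1 : ((γ ^ 2 : ℝ) : ℂ) • v.ofLp -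
        (Bw.map Complex.ofReal)ᴴ *ᵥ P.map Complex.ofReal *ᵥ (z • x) = 0 := by
      ext i
      exact congrFun hker (Sum.inr i)
    exact (sub_eq_zero.1 h1).symm
  have hPy : P₀.map Complex.ofReal *ᵥ y = P.map Complex.ofReal *ᵥ x := by
    rw [hy, mulVec_mulVec, ← map_ofReal_mul, ← Matrix.mul_assoc,
      mul_nonsing_inv _ ((isUnit_iff_isUnit_det _).1 hpos.isUnit), Matrix.one_mul]
  have hdis : (star ((A + B * K₀).map Complex.ofReal *ᵥ y + Bw.map Complex.ofReal *ᵥ v.ofLp) ⬝ᵥ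
      P₀.map Complex.ofReal *ᵥ
        ((A + B * K₀).map Complex.ofReal *ᵥ y + Bw.map Complex.ofReal *ᵥ v.ofLp)).re +
      (star y ⬝ᵥ (Q + K₀ᵀ * R * K₀).map Complex.ofReal *ᵥ y).re ≤
        (star y ⬝ᵥ P₀.map Complex.ofReal *ᵥ y).re + γ₀ ^ 2 * (star v.ofLp ⬝ᵥ v.ofLp).re := by
    have hpsd₀ := hP₀.2.map_ofReal
    rw [map_ofReal_dissipationMatrix] at hpsd₀
    have h1 := (Complex.le_def.1 (hpsd₀.dotProduct_mulVec_nonneg (Sum.elim y v.ofLp))).1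
    rw [dotProduct_dissipationMatrix_mulVec] at h1
    simp only [Complex.sub_re, Complex.add_re, Complex.re_ofReal_mul, Complex.zero_re] at h1
    linarith
  -- The derivative in terms of the adjoint state `P (z x)`.
  have hVx : ((K₀ - K) * P₀⁻¹ * P).map Complex.ofReal *ᵥ x =
      (K₀.map Complex.ofReal - K.map Complex.ofReal) *ᵥ y := by
    rw [Matrix.mul_assoc, map_ofReal_mul, ← mulVec_mulVec, map_ofReal_sub]
  have hslope : star (C *ᵥ x) ⬝ᵥ
      transferSlope A B Bw Q R ((K₀ - K) * P₀⁻¹ * P) K K ω *ᵥ v.ofLp =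
      star (R.map Complex.ofReal *ᵥ K.map Complex.ofReal *ᵥ x) ⬝ᵥ
          (K₀.map Complex.ofReal - K.map Complex.ofReal) *ᵥ y +
        star (P.map Complex.ofReal *ᵥ (z • x)) ⬝ᵥ
          B.map Complex.ofReal *ᵥ (K₀.map Complex.ofReal - K.map Complex.ofReal) *ᵥ y := by
    have hexp : transferSlope A B Bw Q R ((K₀ - K) * P₀⁻¹ * P) K K ω *ᵥ v.ofLp =
        performanceOutput 0 R ((K₀ - K) * P₀⁻¹ * P) *ᵥ x + C *ᵥ closedLoopResolvent A B K ω *ᵥ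
          B.map Complex.ofReal *ᵥ (K₀.map Complex.ofReal - K.map Complex.ofReal) *ᵥ y := by
      rw [transferSlope, ← mulVec_mulVec, ← mulVec_mulVec, ← hx, add_mulVec, ← mulVec_mulVec,
        ← mulVec_mulVec, map_ofReal_mul, ← mulVec_mulVec, hVx]
    have hCC : Cᴴ *ᵥ C *ᵥ x = (z • (1 : Matrix (Fin nx) (Fin nx) ℂ) -
        (A + B * K).map Complex.ofReal)ᴴ *ᵥ P.map Complex.ofReal *ᵥ (z • x) := by
      rw [mulVec_mulVec, hC, conjTranspose_performanceOutput_mul_self hQ hR, conjTranspose_sub,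
        sub_mulVec, hadj, conjTranspose_smul, conjTranspose_one, smul_mulVec, one_mulVec,
        mulVec_smul, smul_smul, Complex.star_def, Complex.conj_mul', hz1]
      simp
    have hRsymm : (R.map Complex.ofReal)ᴴ = R.map Complex.ofReal := hR.map_ofReal.isHermitian.eq
    rw [hexp, dotProduct_add]
    congr 1
    · rw [star_mulVec_dotProduct C x, mulVec_mulVec, hC,
        conjTranspose_performanceOutput_mul_zero hR,
        star_mulVec_dotProduct (R.map Complex.ofReal), hRsymm,
        star_mulVec_dotProduct (K.map Complex.ofReal), ← hVx, conjTranspose_map_ofReal,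
        map_ofReal_mul, map_ofReal_mul]
      simp only [mulVec_mulVec, Matrix.mul_assoc]
    · rw [← conjTranspose_conjTranspose C, ← star_mulVec_dotProduct, conjTranspose_conjTranspose,
        hCC, star_mulVec_dotProduct, conjTranspose_conjTranspose, mulVec_mulVec _ _
          (closedLoopResolvent A B K ω), mul_closedLoopResolvent hK, one_mulVec]
  have hmapS : ∀ K : Matrix (Fin nu) (Fin nx) ℝ, (Q + Kᵀ * R * K).map Complex.ofReal =
      Q.map Complex.ofReal + (K.map Complex.ofReal)ᴴ * R.map Complex.ofReal *
        K.map Complex.ofReal := by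
    intro K
    rw [map_ofReal_add, map_ofReal_mul, map_ofReal_mul, conjTranspose_map_ofReal]
  have hmapA : ∀ K : Matrix (Fin nu) (Fin nx) ℝ, (A + B * K).map Complex.ofReal =
      A.map Complex.ofReal + B.map Complex.ofReal * K.map Complex.ofReal := by
    intro K
    rw [map_ofReal_add, map_ofReal_mul]
  rw [hmapA, hmapS] at hadj hdis
  rw [hmapS] at hmax
  have hfinal := descent_inequality hQ.map_ofReal hR.map_ofReal hpos.posSemidef.map_ofReal hz1 hadj
    hin hPy hdis hv2 hmax
  rw [← Complex.add_re, ← hslope, hCx, star_smul, smul_dotProduct, Complex.star_def,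
    Complex.conj_ofReal, smul_eq_mul, Complex.re_ofReal_mul] at hfinal
  rw [← neg_div, le_div_iff₀ (by positivity)]
  linarith

/-- A frequency together with an output and an input direction; the gain of the closed loop is a
maximum over such triples with directions in the closed unit balls. -/
abbrev TrialPoint (nx nu nw : ℕ) : Type :=
  ℝ × EuclideanSpace ℂ (Fin nx ⊕ Fin nu) × EuclideanSpace ℂ (Fin nw)

theorem continuousAt_re_dotProduct_closedLoopTransfer (hK : K ∈ stabilizingSet A B 1)
    (p : TrialPoint nx nu nw) :
    ContinuousAt (fun y : Matrix (Fin nu) (Fin nx) ℝ × TrialPoint nx nu nw =>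
      (star y.2.2.1.ofLp ⬝ᵥ closedLoopTransfer A B Bw 1 Q R y.1 y.2.1 *ᵥ y.2.2.2.ofLp).re)
      (K, p) := by
  have hT : ContinuousAt (fun y : Matrix (Fin nu) (Fin nx) ℝ × TrialPoint nx nu nw =>
      closedLoopTransfer A B Bw 1 Q R y.1 y.2.1) (K, p) :=
    ContinuousAt.comp
      (f := fun y : Matrix (Fin nu) (Fin nx) ℝ × TrialPoint nx nu nw => (y.1, y.2.1))
      (g := fun y : Matrix (Fin nu) (Fin nx) ℝ × ℝ => closedLoopTransfer A B Bw 1 Q R y.1 y.2)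
      (continuousAt_closedLoopTransfer hK p.1) (Continuous.continuousAt (by fun_prop))
  have hu : ContinuousAt (fun y : Matrix (Fin nu) (Fin nx) ℝ × TrialPoint nx nu nw =>
      y.2.2.1.ofLp) (K, p) := Continuous.continuousAt (by fun_prop)
  have hv : ContinuousAt (fun y : Matrix (Fin nu) (Fin nx) ℝ × TrialPoint nx nu nw =>
      y.2.2.2.ofLp) (K, p) := Continuous.continuousAt (by fun_prop)
  exact continuousAt_re_dotProduct_mulVec hT hu hv

theorem continuousAt_re_dotProduct_transferSlope (hK : K ∈ stabilizingSet A B 1)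
    (V : Matrix (Fin nu) (Fin nx) ℝ) (p : TrialPoint nx nu nw) :
    ContinuousAt (fun y : (Matrix (Fin nu) (Fin nx) ℝ × Matrix (Fin nu) (Fin nx) ℝ) ×
        TrialPoint nx nu nw =>
      (star y.2.2.1.ofLp ⬝ᵥ transferSlope A B Bw Q R V y.1.1 y.1.2 y.2.1 *ᵥ y.2.2.2.ofLp).re)
      ((K, K), p) := by
  have hT : ContinuousAt (fun y : (Matrix (Fin nu) (Fin nx) ℝ × Matrix (Fin nu) (Fin nx) ℝ) ×
      TrialPoint nx nu nw => transferSlope A B Bw Q R V y.1.1 y.1.2 y.2.1) ((K, K), p) :=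
    ContinuousAt.comp
      (f := fun y : (Matrix (Fin nu) (Fin nx) ℝ × Matrix (Fin nu) (Fin nx) ℝ) ×
        TrialPoint nx nu nw => (y.1, y.2.1))
      (g := fun y : (Matrix (Fin nu) (Fin nx) ℝ × Matrix (Fin nu) (Fin nx) ℝ) × ℝ =>
        transferSlope A B Bw Q R V y.1.1 y.1.2 y.2)
      (continuousAt_transferSlope hK V p.1) (Continuous.continuousAt (by fun_prop))
  have hu : ContinuousAt (fun y : (Matrix (Fin nu) (Fin nx) ℝ × Matrix (Fin nu) (Fin nx) ℝ) ×
      TrialPoint nx nu nw => y.2.2.1.ofLp) ((K, K), p) := Continuous.continuousAt (by fun_prop)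
  have hv : ContinuousAt (fun y : (Matrix (Fin nu) (Fin nx) ℝ × Matrix (Fin nu) (Fin nx) ℝ) ×
      TrialPoint nx nu nw => y.2.2.2.ofLp) ((K, K), p) := Continuous.continuousAt (by fun_prop)
  exact continuousAt_re_dotProduct_mulVec hT hu hv

/-- A stabilizing gain with a smaller cost yields a direction of uniform descent. -/
theorem exists_clarkeDirDeriv_hInfCost_lt_zero (hBw : Bw.rank = nx) (hQ : Q.PosDef)
    (hR : R.PosSemidef) (hK : K ∈ stabilizingSet A B 1) (hK₀ : K₀ ∈ stabilizingSet A B 1)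
    (hlt : hInfCost A B Bw 1 Q R K₀ < hInfCost A B Bw 1 Q R K) :
    ∃ V, clarkeDirDeriv (hInfCost A B Bw 1 Q R) K V < 0 := by
  set γ := hInfCost A B Bw 1 Q R K with hγdef
  obtain ⟨γ₀, h0, h1⟩ := exists_between hlt
  have hJ₀ : 0 ≤ hInfCost A B Bw 1 Q R K₀ := hInfCost_nonneg hK₀
  have hγ : 0 < γ := by linarith
  obtain ⟨N, hN⟩ := Matrix.exists_right_inverse_of_rank_eq hBw
  have hS := posDef_cost (K := K) hQ hR
  have hS₀ := posDef_cost (K := K₀) hQ hR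
  obtain ⟨P, hP⟩ := (mem_stabilizingSet_one.1 hK).exists_isStorageMatrix hS.posSemidef hN hγ.le
    (frequency_inequality hQ.posSemidef hR hK)
  obtain ⟨P₀, hP₀⟩ := (mem_stabilizingSet_one.1 hK₀).exists_isStorageMatrix_of_lt
    (by simpa using hS₀.isHermitian.eq) hJ₀ h0 (frequency_inequality hQ.posSemidef hR hK₀)
  have hpos : P₀.PosDef := by
    refine PosDef.of_dotProduct_mulVec_pos
      (by rw [IsHermitian, conjTranspose_eq_transpose_of_trivial, hP₀.1]) fun x hx => ?_
    exact (hS₀.dotProduct_mulVec_pos hx).trans_le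
      (by simpa using hP₀.le (mem_stabilizingSet_one.1 hK₀) hS₀.posSemidef x)
  set V := (K₀ - K) * P₀⁻¹ * P with hV
  refine ⟨V, ?_⟩
  let s : Set (TrialPoint nx nu nw) :=
    Set.Icc (0 : ℝ) (2 * Real.pi) ×ˢ Metric.closedBall 0 1 ×ˢ Metric.closedBall 0 1
  have hs : IsCompact s :=
    isCompact_Icc.prod ((isCompact_closedBall _ _).prod (isCompact_closedBall _ _))
  let φ : Matrix (Fin nu) (Fin nx) ℝ → TrialPoint nx nu nw → ℝ := fun y p =>
    (star p.2.1.ofLp ⬝ᵥ closedLoopTransfer A B Bw 1 Q R y p.1 *ᵥ p.2.2.ofLp).re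
  let q : Matrix (Fin nu) (Fin nx) ℝ → Matrix (Fin nu) (Fin nx) ℝ → TrialPoint nx nu nw → ℝ :=
    fun y y' p =>
    (star p.2.1.ofLp ⬝ᵥ transferSlope A B Bw Q R V y y' p.1 *ᵥ p.2.2.ofLp).re
  have hle : ∀ y ∈ stabilizingSet A B 1, ∀ p ∈ s, φ y p ≤
      sigmaMax (closedLoopTransfer A B Bw 1 Q R y p.1) ∧
        sigmaMax (closedLoopTransfer A B Bw 1 Q R y p.1) ≤ hInfCost A B Bw 1 Q R y := by
    rintro y hy ⟨ω, u, v⟩ ⟨hω, hu, hv⟩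
    obtain ⟨-, -, -, hJ⟩ := exists_hInfCost_eq A B Bw 1 Q R y hy
    exact ⟨re_dotProduct_le_sigmaMax _ (by simpa using hu) (by simpa using hv), hJ ω hω⟩
  have hstab : ∀ᶠ y in 𝓝 K, y ∈ stabilizingSet A B 1 :=
    (isOpen_stabilizingSet A B 1).mem_nhds hK
  refine clarkeDirDeriv_lt_zero_of_isCompact hs (φ := φ) (q := q)
    (δ := (γ ^ 2 - γ₀ ^ 2) / (2 * γ)) ?_ ?_ ?_ ?_ ?_ ?_ ?_
  · have : γ₀ ^ 2 < γ ^ 2 := pow_lt_pow_left₀ h1 (by linarith) two_ne_zero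
    exact div_pos (by linarith) (by linarith)
  · filter_upwards [hstab] with y hy p hp
    exact (hle y hy p hp).1.trans (hle y hy p hp).2
  · filter_upwards [hstab] with y hy
    obtain ⟨ω, hω, hJ, -⟩ := exists_hInfCost_eq A B Bw 1 Q R y hy
    obtain ⟨u, hu, v, hv, huv⟩ := exists_re_dotProduct_eq_sigmaMax
      (closedLoopTransfer A B Bw 1 Q R y ω)
    exact ⟨(ω, u, v), ⟨hω, by simpa using hu, by simpa using hv⟩, huv.trans hJ.symm⟩
  · filter_upwards [hstab.prod_mk hstab] with y hy t ht p hp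
    simp only [φ, q]
    rw [← Complex.sub_re, ← dotProduct_sub, ← sub_mulVec, closedLoopTransfer_sub hy.1 hy.2 ht,
      smul_mulVec, dotProduct_smul, smul_eq_mul, Complex.re_ofReal_mul]
  · exact fun p _ => continuousAt_re_dotProduct_closedLoopTransfer hK p
  · exact fun p _ => continuousAt_re_dotProduct_transferSlope hK V p
  · rintro ⟨ω, u, v⟩ hp heq
    have h3 := hle K hK _ hp
    have hσ : sigmaMax (closedLoopTransfer A B Bw 1 Q R K ω) = γ := by
      refine le_antisymm h3.2 ?_
      exact heq.symm.le.trans h3.1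
    obtain ⟨huv, hu, hv⟩ := singularVectors_of_re_dotProduct_eq_sigmaMax (by rwa [hσ])
      (by simpa using hp.2.1) (by simpa using hp.2.2) (heq.trans hσ.symm)
    rw [hσ] at huv
    exact re_transferSlope_le hQ.posSemidef hR hK hγ hP hP₀ hpos hu hv huv

end

theorem mainTheorem3 {nx nu nw : ℕ}
    (A : Matrix (Fin nx) (Fin nx) ℝ) (B : Matrix (Fin nx) (Fin nu) ℝ)
    (Bw : Matrix (Fin nx) (Fin nw) ℝ)
    (Q : Matrix (Fin nx) (Fin nx) ℝ) (R : Matrix (Fin nu) (Fin nu) ℝ)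
    (hAB : IsStabilizable A B) (hBw : Bw.rank = nx) (hQ : Q.PosDef) (hR : R.PosDef)
    (hne : (stabilizingSet A B (1 : Matrix (Fin nx) (Fin nx) ℝ)).Nonempty)
    (K : Matrix (Fin nu) (Fin nx) ℝ)
    (hK : K ∈ stabilizingSet A B (1 : Matrix (Fin nx) (Fin nx) ℝ)) :
    0 ∈ clarkeSubdifferential (hInfCost A B Bw 1 Q R) K ↔
      K ∈ argMinOn (hInfCost A B Bw 1 Q R) (stabilizingSet A B 1) := by
  constructor
  · refine fun h => ⟨hK, fun K₀ hK₀ => ?_⟩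
    by_contra hlt
    obtain ⟨V, hV⟩ := exists_clarkeDirDeriv_hInfCost_lt_zero hBw hQ hR.posSemidef hK hK₀
      (not_le.1 hlt)
    have h1 := h V
    rw [Matrix.transpose_zero, Matrix.zero_mul, Matrix.trace_zero, EReal.coe_zero] at h1
    exact hV.not_ge h1
  · rintro ⟨-, hmin⟩ V
    rw [Matrix.transpose_zero, Matrix.zero_mul, Matrix.trace_zero, EReal.coe_zero]
    exact (hmin.isLocalMin ((isOpen_stabilizingSet A B 1).mem_nhds hK)).clarkeDirDeriv_nonneg V
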